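/- For $p,q\ge 0$ write ${}_pF_q(a_1,\dots,a_p;b_1,\dots,b_q;z)=\sum_{n\ge 0}\frac{(a_1)_n\cdots(a_p)_n}{(b_1)_n\cdots(b_q)_n}\frac{z^n}{n!}$, where $(x)_n=x(x+1)\cdots(x+n-1)$ is the rising Pochhammer symbol; let $\mathrm{Li}_3(z)=\sum_{k\ge 1} z^k/k^3$ for $|z|<1$, and let $K=\sum_{n\ge 0}\frac{(-1)^n}{(2n+1)^2}$ be Catalan's constant. Then all the series below converge, and $$\sum_{n\ge 0}\frac{1}{(2n+1)^2}\left[\frac{1}{4^n}\binom{2n}{n}\right]^2={}_4F_3\left(\tfrac12,\tfrac12,\tfrac12,\tfrac12;1,\tfrac32,\tfrac32;1\right)=\frac{3\pi^2}{8}+\frac{\log^2 2}{2}-\frac{16}{\pi}\,\mathrm{Im}\,\mathrm{Li}_3\left(\tfrac{1+i}{2}\right),$$ $$\sum_{n\ge 0}\frac{1}{(2n-1)^4}\left[\frac{1}{4^n}\binom{2n}{n}\right]^2={}_4F_3\left(-\tfrac12,-\tfrac12,-\tfrac12,-\tfrac12;1,\tfrac12,\tfrac12;1\right)=\frac{3\pi^2}{8}+\frac{\log^2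 2}{2}-\frac{16}{\pi}\,\mathrm{Im}\,\mathrm{Li}_3\left(\tfrac{1+i}{2}\right)-\frac{8}{\pi}(K-1).$$ -/

import Mathlib

noncomputable section

/-- The `n`-th term `(a₁)ₙ ⋯ (a_p)ₙ / ((b₁)ₙ ⋯ (b_q)ₙ) · zⁿ / n!` of the generalized hypergeometric
series with upper parameters `a`, lower parameters `b` and argument `z`; `(x)ₙ` is the rising
Pochhammer symbol. -/
def hypergeometricTerm {p q : ℕ} (a : Fin p → ℝ) (b : Fin q → ℝ) (z : ℝ) (n : ℕ) : ℝ :=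
  (∏ i, (ascPochhammer ℝ n).eval (a i)) / (∏ j, (ascPochhammer ℝ n).eval (b j)) *
    (z ^ n / (n.factorial : ℝ))

/-- The generalized hypergeometric function `pFq(a; b; z)`, as the sum of its series. -/
def hypergeometricPFQ {p q : ℕ} (a : Fin p → ℝ) (b : Fin q → ℝ) (z : ℝ) : ℝ :=
  ∑' n : ℕ, hypergeometricTerm a b z n

/-- The polylogarithm `Li_s(z) = ∑_{k ≥ 1} z^k / k^s`, for `|z| < 1`. -/
def polyLog (s : ℕ) (z : ℂ) : ℂ :=
  ∑' k : ℕ, z ^ (k + 1) / ((k : ℂ) + 1) ^ s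

/-- Catalan's constant `∑_{n ≥ 0} (-1)^n / (2n+1)^2`. -/
def catalanConstant : ℝ :=
  ∑' n : ℕ, (-1 : ℝ) ^ n / (2 * (n : ℝ) + 1) ^ 2

end

/-!
Write `β n = C(2n, n) / 4 ^ n`. The arcsine series reads `∑ β n sin²ⁿ θ / (2n + 1) = θ / sin θ`.
Integrating it over `[0, π / 2]` gives `∑ (β n)² / (2n + 1) = 4 K / π`, and integrating it against
`-cos θ log tan (θ / 2)`, whose moments are `(π / 2) β n / (2n + 1)`, turns `∑ (β n)² / (2n + 1)²`
into `-(2 / π) ∫ θ cot θ log tan (θ / 2) dθ`.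

Integration by parts leaves `∫ log tan (θ / 2) log (2 sin θ) dθ` and `∫ θ log (2 sin θ) / sin θ dθ`.
The substitution `x = tan (θ / 2)` evaluates the second one through the inverse tangent integrals
and `Im S₁,₂ (i)`, with `S₁,₂` the Nielsen polylogarithm. In the first one the integrand is, up to a
linear term, the real part of `log² (1 - z) - log² (1 + z)` at `z = exp (i θ)`, and this function
divided by `z` has a primitive built from `S₁,₂`. Finally, Landen's identity for the trilogarithm
at `z = i`, where `z / (z - 1) = (1 - i) / 2`, expresses `S₁,₂ (i)` through `Li₃ ((1 + i) / 2)`.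

The second series reduces to the first one because `β (n + 1) = β n (2n + 1) / (2n + 2)`: in partial
fractions its terms are those of the two sums above and of a telescoping sum.
-/

open Real Filter Topology MeasureTheory Set

/-- The normalized central binomial coefficient `C(2n, n) / 4^n`, equal to `(1/2)ₙ / n!`. -/
noncomputable def centralRatio (n : ℕ) : ℝ := 1 / 4 ^ n * ((2 * n).choose n : ℝ)

theorem centralRatio_zero : centralRatio 0 = 1 := by simp [centralRatio]

theorem centralRatio_succ (n : ℕ) :
    centralRatio (n + 1) = centralRatio n * ((2 * n + 1) / (2 * n + 2)) := by
  have h : ((n : ℝ) + 1) * ((2 * (n + 1)).choose (n + 1) : ℝ) =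
      2 * (2 * n + 1) * ((2 * n).choose n : ℝ) := by
    exact_mod_cast n.succ_mul_centralBinom_succ
  unfold centralRatio
  field_simp
  linear_combination 2 * 4 ^ n * h

theorem centralRatio_pos (n : ℕ) : 0 < centralRatio n :=
  mul_pos (by positivity) (by exact_mod_cast Nat.choose_pos (by lia))

theorem centralRatio_le_one (n : ℕ) : centralRatio n ≤ 1 := by
  induction n with
  | zero => simp [centralRatio_zero]
  | succ n ih =>
    rw [centralRatio_succ]
    refine mul_le_one₀ ih (by positivity) ?_
    rw [div_le_one (by positivity)]
    linarith

theorem wallis_eq_centralRatio (n : ℕ) :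
    Real.Wallis.W n = 1 / (centralRatio n ^ 2 * (2 * n + 1)) := by
  induction n with
  | zero => simp [centralRatio_zero, Real.Wallis.W]
  | succ n ih =>
    rw [Real.Wallis.W_succ, ih, centralRatio_succ]
    have := (centralRatio_pos n).ne'
    push_cast
    field_simp
    ring

theorem tendsto_centralRatio_sq_mul :
    Tendsto (fun n : ℕ => centralRatio n ^ 2 * (8 * n + 1)) atTop (𝓝 (8 / π)) := by
  have h_inv : Tendsto (fun n : ℕ => 3 / (2 * (n : ℝ) + 1)) atTop (𝓝 0) :=
    tendsto_const_nhds.div_atTop (tendsto_atTop_add_const_right _ _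
      (tendsto_natCast_atTop_atTop.const_mul_atTop two_pos))
  have h := (Real.Wallis.tendsto_W_nhds_pi_div_two.inv₀ (by positivity)).mul (h_inv.const_sub 4)
  have h_lim : (π / 2)⁻¹ * (4 - 0) = 8 / π := by field_simp; norm_num
  rw [h_lim] at h
  refine h.congr fun n => ?_
  have := (centralRatio_pos n).ne'
  rw [wallis_eq_centralRatio]
  field_simp
  ring

theorem hasSum_of_tendsto_of_sub_eq {f g : ℕ → ℝ} {l : ℝ} (hg : ∀ n, g (n + 1) - g n = f n)
    (hf : ∀ n, 0 ≤ f n) (hl : Tendsto g atTop (𝓝 l)) : HasSum f (l - g 0) := by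
  rw [hasSum_iff_tendsto_nat_of_nonneg hf]
  simp_rw [← hg, Finset.sum_range_sub]
  exact hl.sub_const _

theorem hasSum_centralRatio_sq_mul :
    HasSum (fun n : ℕ => centralRatio n ^ 2 * (1 / (n + 1) + 1 / (4 * (n + 1) ^ 2)))
      (8 / π - 1) := by
  have h_sub (n : ℕ) :
      centralRatio (n + 1) ^ 2 * (8 * (n + 1 : ℕ) + 1) - centralRatio n ^ 2 * (8 * n + 1) =
        centralRatio n ^ 2 * (1 / (n + 1) + 1 / (4 * (n + 1) ^ 2)) := by
    rw [centralRatio_succ]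
    push_cast
    field_simp
    ring
  simpa [centralRatio_zero] using
    hasSum_of_tendsto_of_sub_eq h_sub (fun n => by positivity) tendsto_centralRatio_sq_mul

theorem ascPochhammer_eval_one_half (n : ℕ) :
    (ascPochhammer ℝ n).eval (1 / 2) = centralRatio n * n.factorial := by
  induction n with
  | zero => simp [centralRatio_zero]
  | succ n ih =>
    rw [ascPochhammer_succ_eval, ih, centralRatio_succ, Nat.factorial_succ]
    push_cast
    field_simp
    ring

theorem ascPochhammer_eval_three_halves (n : ℕ) :
    (ascPochhammer ℝ n).eval (3 / 2) = (2 * n + 1) * (centralRatio n * n.factorial) := by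
  induction n with
  | zero => simp [centralRatio_zero]
  | succ n ih =>
    rw [ascPochhammer_succ_eval, ih, centralRatio_succ, Nat.factorial_succ]
    push_cast
    field_simp
    ring

theorem two_mul_natCast_sub_one_ne_zero (n : ℕ) : 2 * (n : ℝ) - 1 ≠ 0 := by
  rw [sub_ne_zero]
  exact_mod_cast (by lia : 2 * n ≠ 1)

theorem ascPochhammer_eval_neg_one_half (n : ℕ) :
    (ascPochhammer ℝ n).eval (-1 / 2) = -(centralRatio n * n.factorial) / (2 * n - 1) := by
  induction n with
  | zero => simp [centralRatio_zero]
  | succ n ih =>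
    have := two_mul_natCast_sub_one_ne_zero n
    have h_sub : 2 * ((n + 1 : ℕ) : ℝ) - 1 = 2 * n + 1 := by push_cast; ring
    rw [ascPochhammer_succ_eval, ih, centralRatio_succ, Nat.factorial_succ, h_sub]
    push_cast
    field_simp
    ring

theorem hypergeometricTerm_one_half (n : ℕ) :
    hypergeometricTerm ![1/2, 1/2, 1/2, 1/2] ![1, 3/2, 3/2] 1 n =
      1 / (2 * (n : ℝ) + 1) ^ 2 * centralRatio n ^ 2 := by
  have := (centralRatio_pos n).ne'
  simp only [hypergeometricTerm, Fin.prod_univ_four, Fin.prod_univ_three, Matrix.cons_val_zero,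
    Matrix.cons_val_one, Matrix.cons_val, ascPochhammer_eval_one_half,
    ascPochhammer_eval_three_halves, ascPochhammer_eval_one, one_pow]
  field_simp

theorem hypergeometricTerm_neg_one_half (n : ℕ) :
    hypergeometricTerm ![-1/2, -1/2, -1/2, -1/2] ![1, 1/2, 1/2] 1 n =
      1 / (2 * (n : ℝ) - 1) ^ 4 * centralRatio n ^ 2 := by
  have := (centralRatio_pos n).ne'
  have := two_mul_natCast_sub_one_ne_zero n
  simp only [hypergeometricTerm, Fin.prod_univ_four, Fin.prod_univ_three, Matrix.cons_val_zero,
    Matrix.cons_val_one, Matrix.cons_val, ascPochhammer_eval_one_half,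
    ascPochhammer_eval_neg_one_half, ascPochhammer_eval_one, one_pow]
  field_simp

theorem integral_sin_pow_even_zero_pi_div_two (n : ℕ) :
    ∫ x in (0 : ℝ)..(π / 2), sin x ^ (2 * n) = π / 2 * centralRatio n := by
  induction n with
  | zero => simp [centralRatio_zero]
  | succ n ih =>
    rw [mul_add_one, integral_sin_pow, ih, centralRatio_succ]
    simp
    ring

theorem hasSum_centralRatio_mul_pow {x : ℝ} (hx : |x| < 1) :
    HasSum (fun n => centralRatio n * x ^ n) (1 / √(1 - x)) := by
  have h := (Real.one_div_one_sub_rpow_hasFPowerSeriesOnBall_zero (1 / 2)).hasSum (y := x) (by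
    simpa [enorm_eq_nnnorm, ← NNReal.coe_lt_coe] using hx)
  rw [zero_add, ← Real.sqrt_eq_rpow] at h
  refine h.congr_fun fun n => ?_
  have h_choose : Ring.choose ((1 : ℝ) / 2 + n - 1) n = centralRatio n := by
    have h_poch := Ring.descPochhammer_eq_factorial_smul_choose ((1 : ℝ) / 2 + n - 1) n
    rw [Polynomial.descPochhammer_smeval_eq_ascPochhammer, sub_right_comm, sub_add_cancel,
      add_sub_cancel_right, Polynomial.ascPochhammer_smeval_eq_eval, ascPochhammer_eval_one_half,
      nsmul_eq_mul, mul_comm] at h_poch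
    exact (mul_left_cancel₀ (by positivity) h_poch).symm
  simp [FormalMultilinearSeries.ofScalars, ← h_choose, mul_comm]

theorem integral_one_div_sqrt_one_sub_sq {x : ℝ} (hx : |x| < 1) :
    ∫ t in (0 : ℝ)..x, 1 / √(1 - t ^ 2) = arcsin x := by
  have h_lt : ∀ t ∈ uIcc 0 x, |t| < 1 := fun t ht =>
    lt_of_le_of_lt (by simpa using abs_sub_left_of_mem_uIcc ht) hx
  rw [intervalIntegral.integral_eq_sub_of_hasDerivAt (f := arcsin), arcsin_zero, sub_zero]
  · intro t ht
    have := abs_lt.mp (h_lt t ht)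
    exact hasDerivAt_arcsin this.1.ne' this.2.ne
  · refine (ContinuousOn.div (by fun_prop) (by fun_prop) fun t ht => ?_).intervalIntegrable
    exact (Real.sqrt_pos.mpr (by linarith [(sq_lt_one_iff_abs_lt_one t).mpr (h_lt t ht)])).ne'

theorem hasSum_arcsin {x : ℝ} (hx : |x| < 1) :
    HasSum (fun n : ℕ => centralRatio n / (2 * n + 1) * x ^ (2 * n + 1)) (arcsin x) := by
  have h_le : ∀ t ∈ uIoc 0 x, |t| ≤ |x| := fun t ht => by
    simpa using abs_sub_left_of_mem_uIcc (uIoc_subset_uIcc ht)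
  have h_bound (n : ℕ) (t : ℝ) (ht : t ∈ uIoc 0 x) :
      ‖centralRatio n * (t ^ 2) ^ n‖ ≤ (x ^ 2) ^ n := by
    rw [norm_mul, Real.norm_eq_abs, abs_of_pos (centralRatio_pos n), norm_pow, Real.norm_eq_abs,
      abs_sq]
    exact (mul_le_of_le_one_left (by positivity) (centralRatio_le_one n)).trans
      (pow_le_pow_left₀ (sq_nonneg t) (sq_le_sq.mpr (h_le t ht)) n)
  have h := intervalIntegral.hasSum_integral_of_dominated_convergence (μ := volume)
    (fun n _ => (x ^ 2) ^ n) (fun n => by fun_prop) (fun n => ae_of_all _ (h_bound n))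
    (ae_of_all _ fun _ _ => summable_geometric_of_lt_one (sq_nonneg x)
      ((sq_lt_one_iff_abs_lt_one x).mpr hx))
    intervalIntegrable_const (ae_of_all _ fun t ht => hasSum_centralRatio_mul_pow (x := t ^ 2) (by
      simpa using (h_le t ht).trans_lt hx))
  rw [integral_one_div_sqrt_one_sub_sq hx] at h
  refine h.congr_fun fun n => ?_
  simp_rw [← pow_mul]
  simp [mul_div_assoc, div_mul_eq_mul_div]

theorem hasSum_centralRatio_div_mul_sin_pow {θ : ℝ} (hθ : θ ∈ Ioo 0 (π / 2)) :
    HasSum (fun n : ℕ => centralRatio n / (2 * n + 1) * sin θ ^ (2 * n)) (θ / sin θ) := by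
  have h_pos : 0 < sin θ := sin_pos_of_pos_of_lt_pi hθ.1 (by linarith [hθ.2, pi_pos])
  have h_lt : sin θ < 1 := by
    simpa using sin_lt_sin_of_lt_of_le_pi_div_two (by linarith [hθ.1, pi_pos]) le_rfl hθ.2
  have h := (hasSum_arcsin (by rwa [abs_of_pos h_pos])).div_const (sin θ)
  rw [arcsin_sin (by linarith [hθ.1, pi_pos]) hθ.2.le] at h
  refine h.congr_fun fun n => ?_
  rw [pow_succ]
  field_simp

theorem norm_polyLog_term_le (s k : ℕ) {z : ℂ} (hz : ‖z‖ ≤ 1) :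
    ‖z ^ (k + 1) / ((k : ℂ) + 1) ^ s‖ ≤ 1 / ((k : ℝ) + 1) ^ s * ‖z‖ := by
  have h_norm : ‖(k : ℂ) + 1‖ = (k : ℝ) + 1 := by
    exact_mod_cast Complex.norm_natCast (k + 1)
  rw [norm_div, norm_pow, norm_pow, h_norm, one_div_mul_eq_div]
  gcongr
  exact pow_le_of_le_one (norm_nonneg z) hz k.succ_ne_zero

theorem summable_one_div_succ_pow {s : ℕ} (hs : 2 ≤ s) :
    Summable fun k : ℕ => 1 / ((k : ℝ) + 1) ^ s := by
  exact_mod_cast (summable_nat_add_iff 1).mpr (Real.summable_one_div_nat_pow.mpr hs)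

theorem hasSum_polyLog {s : ℕ} (hs : 2 ≤ s) {z : ℂ} (hz : ‖z‖ ≤ 1) :
    HasSum (fun k : ℕ => z ^ (k + 1) / ((k : ℂ) + 1) ^ s) (polyLog s z) :=
  (((summable_one_div_succ_pow hs).mul_right ‖z‖).of_norm_bounded
    fun k => norm_polyLog_term_le s k hz).hasSum

theorem norm_polyLog_le {s : ℕ} (hs : 2 ≤ s) {z : ℂ} (hz : ‖z‖ ≤ 1) :
    ‖polyLog s z‖ ≤ (∑' k : ℕ, 1 / ((k : ℝ) + 1) ^ s) * ‖z‖ :=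
  tsum_of_norm_bounded ((summable_one_div_succ_pow hs).hasSum.mul_right ‖z‖)
    fun k => norm_polyLog_term_le s k hz

theorem continuousOn_polyLog {s : ℕ} (hs : 2 ≤ s) :
    ContinuousOn (polyLog s) (Metric.closedBall 0 1) := by
  refine continuousOn_tsum (fun k => by fun_prop) (summable_one_div_succ_pow hs) fun k z hz => ?_
  rw [mem_closedBall_zero_iff] at hz
  exact (norm_polyLog_term_le s k hz).trans (mul_le_of_le_one_right (by positivity) hz)

theorem polyLog_zero_right (s : ℕ) : polyLog s 0 = 0 := by simp [polyLog]

theorem polyLog_one_eq {z : ℂ} (hz : ‖z‖ < 1) : polyLog 1 z = -Complex.log (1 - z) := by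
  have h := (hasSum_nat_add_iff' 1).mpr (Complex.hasSum_taylorSeries_neg_log hz)
  simpa [polyLog] using h.tsum_eq

theorem polyLog_conj (s : ℕ) (z : ℂ) :
    polyLog s (starRingEnd ℂ z) = starRingEnd ℂ (polyLog s z) := by
  simp [polyLog, Complex.conj_tsum]

theorem hasDerivAt_polyLog (s : ℕ) {z : ℂ} (hz : ‖z‖ < 1) (hz0 : z ≠ 0) :
    HasDerivAt (polyLog (s + 1)) (polyLog s z / z) z := by
  obtain ⟨r, hzr, hr⟩ := exists_between hz
  have h_ne (k : ℕ) : (k : ℂ) + 1 ≠ 0 := Nat.cast_add_one_ne_zero k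
  have h_deriv (k : ℕ) (w : ℂ) : HasDerivAt (fun w => w ^ (k + 1) / ((k : ℂ) + 1) ^ (s + 1))
      (w ^ k / ((k : ℂ) + 1) ^ s) w := by
    refine ((hasDerivAt_pow (k + 1) w).div_const _).congr_deriv ?_
    have := h_ne k
    push_cast
    rw [pow_succ]
    field_simp
  have h_bound (k : ℕ) (w : ℂ) (hw : w ∈ Metric.ball 0 r) :
      ‖w ^ k / ((k : ℂ) + 1) ^ s‖ ≤ r ^ k := by
    have h_one : 1 ≤ ‖((k : ℂ) + 1) ^ s‖ := by
      rw [norm_pow, ← Nat.cast_succ, Complex.norm_natCast]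
      exact one_le_pow₀ (by simp)
    rw [norm_div, norm_pow]
    exact (div_le_self (by positivity) h_one).trans
      (pow_le_pow_left₀ (norm_nonneg w) (mem_ball_zero_iff.mp hw).le k)
  have h := hasDerivAt_tsum_of_isPreconnected (y₀ := 0) (y := z)
    (summable_geometric_of_lt_one ((norm_nonneg z).trans hzr.le) hr) Metric.isOpen_ball
    (convex_ball 0 r).isPreconnected (fun k w _ => h_deriv k w) h_bound
    (Metric.mem_ball_self ((norm_nonneg z).trans_lt hzr)) (by simp) (mem_ball_zero_iff.mpr hzr)
  refine h.congr_deriv ?_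
  rw [polyLog, ← tsum_div_const]
  exact tsum_congr fun k => by rw [pow_succ]; field_simp

-- The summand at `n = 0` is `1 / 0 = 0`.
theorem hasSum_polyLog_nat {s : ℕ} (hs : 2 ≤ s) {z : ℂ} (hz : ‖z‖ ≤ 1) :
    HasSum (fun n : ℕ => z ^ n / (n : ℂ) ^ s) (polyLog s z) := by
  rw [← hasSum_nat_add_iff' 1]
  simpa [show s ≠ 0 by lia] using hasSum_polyLog hs hz

theorem hasSum_polyLog_exp {s : ℕ} (hs : 2 ≤ s) (x : ℝ) :
    HasSum (fun n : ℕ => Complex.exp ((2 * π * n * x : ℝ) * Complex.I) / ((n ^ s : ℝ) : ℂ))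
      (polyLog s (Complex.exp ((2 * π * x : ℝ) * Complex.I))) := by
  refine (hasSum_polyLog_nat hs (Complex.norm_exp_ofReal_mul_I _).le).congr_fun fun n => ?_
  rw [← Complex.exp_nat_mul]
  push_cast
  ring_nf

theorem polyLog_two_mul_exp_re {k : ℕ} (hk : k ≠ 0) {x : ℝ} (hx : x ∈ Icc (0 : ℝ) 1) :
    (polyLog (2 * k) (Complex.exp ((2 * π * x : ℝ) * Complex.I))).re =
      (-1) ^ (k + 1) * (2 * π) ^ (2 * k) / 2 / (2 * k).factorial *
        ((Polynomial.bernoulli (2 * k)).map (algebraMap ℚ ℝ)).eval x := by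
  refine (Complex.hasSum_re (hasSum_polyLog_exp (by lia) x)).unique
    ((hasSum_one_div_nat_pow_mul_cos hk hx).congr_fun fun n => ?_)
  rw [Complex.div_ofReal_re, Complex.exp_ofReal_mul_I_re, one_div_mul_eq_div]

theorem polyLog_two_mul_add_one_exp_im {k : ℕ} (hk : k ≠ 0) {x : ℝ} (hx : x ∈ Icc (0 : ℝ) 1) :
    (polyLog (2 * k + 1) (Complex.exp ((2 * π * x : ℝ) * Complex.I))).im =
      (-1) ^ (k + 1) * (2 * π) ^ (2 * k + 1) / 2 / (2 * k + 1).factorial *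
        ((Polynomial.bernoulli (2 * k + 1)).map (algebraMap ℚ ℝ)).eval x := by
  refine (Complex.hasSum_im (hasSum_polyLog_exp (by lia) x)).unique
    ((hasSum_one_div_nat_pow_mul_sin hk hx).congr_fun fun n => ?_)
  rw [Complex.div_ofReal_im, Complex.exp_ofReal_mul_I_im, one_div_mul_eq_div]

theorem exp_two_pi_mul_one_quarter_mul_I :
    Complex.exp ((2 * π * (1 / 4) : ℝ) * Complex.I) = Complex.I := by
  rw [show 2 * π * (1 / 4) = π / 2 by ring]
  push_cast
  exact Complex.exp_pi_div_two_mul_I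

theorem polyLog_two_I_re : (polyLog 2 Complex.I).re = -(π ^ 2 / 48) := by
  have h := polyLog_two_mul_exp_re one_ne_zero (x := 1 / 4) (by constructor <;> norm_num)
  have h_bernoulli : ((Polynomial.bernoulli 2).map (algebraMap ℚ ℝ)).eval (1 / 4) = -1 / 48 := by
    norm_num [Polynomial.bernoulli_def, Finset.sum_range_succ, Nat.choose, bernoulli_one]
  rw [exp_two_pi_mul_one_quarter_mul_I] at h
  norm_num [h_bernoulli] at h
  rw [h]
  ring

theorem polyLog_three_I_im : (polyLog 3 Complex.I).im = π ^ 3 / 32 := by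
  have h := polyLog_two_mul_add_one_exp_im one_ne_zero (x := 1 / 4) (by constructor <;> norm_num)
  have h_bernoulli : ((Polynomial.bernoulli 3).map (algebraMap ℚ ℝ)).eval (1 / 4) = 3 / 64 := by
    have := congrArg (algebraMap ℚ ℝ) Polynomial.bernoulli_three_eval_one_quarter
    rw [← Polynomial.eval_map_apply] at this
    simpa using this
  rw [exp_two_pi_mul_one_quarter_mul_I] at h
  norm_num [h_bernoulli, Nat.factorial] at h
  rw [h]
  ring

theorem polyLog_two_I_im : (polyLog 2 Complex.I).im = catalanConstant := by
  have h := Complex.hasSum_im (hasSum_polyLog_nat le_rfl (z := Complex.I) (by simp))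
  have h_inj : Function.Injective fun m : ℕ => 2 * m + 1 := fun a b hab => by simpa using hab
  rw [← h_inj.hasSum_iff fun k hk => ?_] at h
  · refine (h.congr_fun fun m => ?_).tsum_eq.symm
    have h_odd : Complex.I ^ (2 * m + 1) / ((2 * m + 1 : ℕ) : ℂ) ^ 2 =
        ((-1) ^ m / (2 * m + 1) ^ 2 : ℝ) * Complex.I := by
      rw [pow_succ, pow_mul, Complex.I_sq]
      push_cast
      ring
    rw [Function.comp_apply, h_odd, Complex.im_ofReal_mul, Complex.I_im, mul_one]
  · obtain ⟨m, rfl⟩ : Even k := by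
      rw [← Nat.not_odd_iff_even]
      exact fun ⟨m, hm⟩ => hk ⟨m, hm.symm⟩
    have h_even : Complex.I ^ (m + m) / ((m + m : ℕ) : ℂ) ^ 2 =
        ((-1) ^ m / (m + m) ^ 2 : ℝ) := by
      rw [← two_mul, pow_mul, Complex.I_sq]
      push_cast
      ring
    rw [h_even, Complex.ofReal_im]

theorem one_sub_mem_slitPlane_of_norm_lt_one {z : ℂ} (hz : ‖z‖ < 1) :
    1 - z ∈ Complex.slitPlane := by
  simpa [sub_eq_add_neg] using Complex.mem_slitPlane_of_norm_lt_one (z := -z) (by simpa using hz)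

theorem one_sub_mem_slitPlane_of_re_le {z : ℂ} (hre : z.re ≤ 1 / 2) :
    1 - z ∈ Complex.slitPlane :=
  Or.inl (by rw [Complex.sub_re, Complex.one_re]; linarith)

theorem one_sub_ofReal_mul_mem_slitPlane {z : ℂ} (hz : 1 - z ∈ Complex.slitPlane) {s : ℝ}
    (hs : s ∈ Icc (0 : ℝ) 1) : 1 - s * z ∈ Complex.slitPlane := by
  have h := Complex.starConvex_one_slitPlane.add_smul_mem (y := -z)
    (by rwa [← sub_eq_add_neg]) hs.1 hs.2
  rwa [Complex.real_smul, mul_neg, ← sub_eq_add_neg] at h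

theorem hasDerivAt_log_one_sub {z : ℂ} (hz : 1 - z ∈ Complex.slitPlane) :
    HasDerivAt (fun w : ℂ => Complex.log (1 - w)) (-1 / (1 - z)) z :=
  ((hasDerivAt_id z).const_sub 1).clog hz

theorem integral_mul_eq_sub_of_hasDerivAt_segment {F F' : ℂ → ℂ} {z : ℂ}
    (hF : ContinuousOn (fun s : ℝ => F (s * z)) (Icc 0 1))
    (hF' : ∀ s ∈ Ioo (0 : ℝ) 1, HasDerivAt F (F' (s * z)) (s * z))
    (h_int : IntervalIntegrable (fun s : ℝ => F' (s * z) * z) volume 0 1) :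
    ∫ s in (0 : ℝ)..1, F' (s * z) * z = F z - F 0 := by
  have h_deriv (s : ℝ) (hs : s ∈ Ioo (0 : ℝ) 1) :
      HasDerivAt (fun t : ℝ => F (t * z)) (F' (s * z) * z) s := by
    have h_line : HasDerivAt (fun w : ℂ => w * z) z (s : ℂ) := by
      simpa using (hasDerivAt_id (s : ℂ)).mul_const z
    exact ((hF' s hs).comp (s : ℂ) h_line).comp_ofReal
  simpa using intervalIntegral.integral_eq_sub_of_hasDerivAt_of_le zero_le_one hF h_deriv h_int

/-- The Nielsen polylogarithm `S₁,₂(z) = ½ ∫₀¹ log² (1 - s z) ds / s`, the primitive of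
`log² (1 - z) / (2 z)` that vanishes at `0`. -/
noncomputable def nielsenPolyLog (z : ℂ) : ℂ :=
  ∫ s in (0 : ℝ)..1, Complex.log (1 - s * z) ^ 2 / (2 * s)

theorem nielsenPolyLog_zero : nielsenPolyLog 0 = 0 := by simp [nielsenPolyLog]

theorem nielsenPolyLog_conj {z : ℂ} (hz : 1 - z ∈ Complex.slitPlane) :
    nielsenPolyLog (starRingEnd ℂ z) = starRingEnd ℂ (nielsenPolyLog z) := by
  rw [nielsenPolyLog, nielsenPolyLog, ← intervalIntegral.intervalIntegral_conj]
  refine intervalIntegral.integral_congr fun s hs => ?_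
  rw [uIcc_of_le zero_le_one] at hs
  have h_arg := Complex.slitPlane_arg_ne_pi (one_sub_ofReal_mul_mem_slitPlane hz hs)
  simp [← Complex.log_conj _ h_arg, Complex.conj_ofNat]

theorem dslope_log_one_sub_sq_div_two {z : ℂ} (hz : z ≠ 0) :
    dslope (fun w => Complex.log (1 - w) ^ 2 / 2) 0 z = Complex.log (1 - z) ^ 2 / (2 * z) := by
  rw [dslope_of_ne _ hz, slope_def_field]
  simp [div_div]

theorem differentiableOn_dslope_log_one_sub_sq_div_two :
    DifferentiableOn ℂ (dslope (fun w => Complex.log (1 - w) ^ 2 / 2) 0)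
      {z | 1 - z ∈ Complex.slitPlane} := by
  have h_open : IsOpen {z : ℂ | 1 - z ∈ Complex.slitPlane} :=
    Complex.isOpen_slitPlane.preimage (by fun_prop)
  rw [Complex.differentiableOn_dslope (h_open.mem_nhds (by simp))]
  exact fun z hz => ((hasDerivAt_log_one_sub hz).differentiableAt.pow 2).div_const 2
    |>.differentiableWithinAt

theorem intervalIntegrable_log_one_sub_sq_div {z : ℂ} (hz : 1 - z ∈ Complex.slitPlane) :
    IntervalIntegrable (fun s : ℝ => Complex.log (1 - s * z) ^ 2 / (2 * (s * z)) * z)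
      volume 0 1 := by
  rcases eq_or_ne z 0 with rfl | hz0
  · simp
  have h_cont : ContinuousOn
      (fun s : ℝ => dslope (fun w => Complex.log (1 - w) ^ 2 / 2) 0 (s * z) * z) (uIcc 0 1) := by
    rw [uIcc_of_le zero_le_one]
    exact (differentiableOn_dslope_log_one_sub_sq_div_two.continuousOn.comp (by fun_prop)
      fun s hs => one_sub_ofReal_mul_mem_slitPlane hz hs).mul continuousOn_const
  refine h_cont.intervalIntegrable.congr fun s hs => ?_
  rw [uIoc_of_le zero_le_one] at hs
  have hs0 : (s : ℂ) ≠ 0 := by exact_mod_cast hs.1.ne'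
  simp only [dslope_log_one_sub_sq_div_two (mul_ne_zero hs0 hz0)]

theorem nielsenPolyLog_eq_sub {F : ℂ → ℂ} {z : ℂ} (hz : 1 - z ∈ Complex.slitPlane)
    (hF : ContinuousOn (fun s : ℝ => F (s * z)) (Icc 0 1))
    (hF' : ∀ s ∈ Ioo (0 : ℝ) 1,
      HasDerivAt F (Complex.log (1 - s * z) ^ 2 / (2 * (s * z))) (s * z)) :
    nielsenPolyLog z = F z - F 0 := by
  rw [← integral_mul_eq_sub_of_hasDerivAt_segment
    (F' := fun w => Complex.log (1 - w) ^ 2 / (2 * w)) hF hF'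
    (intervalIntegrable_log_one_sub_sq_div hz), nielsenPolyLog]
  refine intervalIntegral.integral_congr fun s _ => ?_
  rcases eq_or_ne z 0 with rfl | hz0
  · simp
  · field_simp

theorem hasDerivAt_nielsenPolyLog {z : ℂ} (hz : ‖z‖ < 1) (hz0 : z ≠ 0) :
    HasDerivAt nielsenPolyLog (Complex.log (1 - z) ^ 2 / (2 * z)) z := by
  have h_diff := differentiableOn_dslope_log_one_sub_sq_div_two.mono
    fun w (hw : w ∈ Metric.ball 0 1) =>
      one_sub_mem_slitPlane_of_norm_lt_one (mem_ball_zero_iff.mp hw)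
  obtain ⟨F, hF0, hF⟩ := h_diff.isExactOn_ball.with_val_at 0 0
  have h_eq : ∀ w ∈ Metric.ball (0 : ℂ) 1, nielsenPolyLog w = F w := fun w hw => by
    rcases eq_or_ne w 0 with rfl | hw0
    · rw [hF0, nielsenPolyLog_zero]
    have h_mem (s : ℝ) (hs : s ∈ Icc (0 : ℝ) 1) : (s * w : ℂ) ∈ Metric.ball (0 : ℂ) 1 := by
      rw [mem_ball_zero_iff] at hw ⊢
      rw [norm_mul, Complex.norm_real, Real.norm_of_nonneg hs.1]
      exact (mul_le_of_le_one_left (norm_nonneg w) hs.2).trans_lt hw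
    rw [nielsenPolyLog_eq_sub (one_sub_mem_slitPlane_of_norm_lt_one (mem_ball_zero_iff.mp hw))
      (F := F), hF0, sub_zero]
    · exact ContinuousOn.comp (fun u hu => (hF u hu).continuousAt.continuousWithinAt)
        (by fun_prop) h_mem
    · intro s hs
      have hs0 : (s : ℂ) ≠ 0 := by exact_mod_cast hs.1.ne'
      rw [← dslope_log_one_sub_sq_div_two (mul_ne_zero hs0 hw0)]
      exact hF _ (h_mem s (Ioo_subset_Icc_self hs))
  have h_mem : z ∈ Metric.ball (0 : ℂ) 1 := mem_ball_zero_iff.mpr hz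
  rw [← dslope_log_one_sub_sq_div_two hz0]
  exact (hF z h_mem).congr_of_eventuallyEq
    (Filter.eventuallyEq_of_mem (Metric.isOpen_ball.mem_nhds h_mem) h_eq)

theorem norm_div_sub_one_le_one {z : ℂ} (hre : z.re ≤ 1 / 2) : ‖z / (z - 1)‖ ≤ 1 := by
  rw [norm_div]
  refine div_le_one_of_le₀ (le_of_sq_le_sq ?_ (norm_nonneg _)) (norm_nonneg _)
  rw [Complex.sq_norm, Complex.sq_norm, Complex.normSq_sub]
  simp
  linarith

theorem norm_div_sub_one_lt_one {z : ℂ} (hre : z.re < 1 / 2) : ‖z / (z - 1)‖ < 1 := by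
  have hz : 0 < ‖z - 1‖ := norm_pos_iff.mpr (sub_ne_zero.mpr fun h => by norm_num [h] at hre)
  rw [norm_div, div_lt_one hz]
  refine lt_of_pow_lt_pow_left₀ 2 (norm_nonneg _) ?_
  rw [Complex.sq_norm, Complex.sq_norm, Complex.normSq_sub]
  simp
  linarith

theorem hasDerivAt_polyLog_div_sub_one (s : ℕ) {z : ℂ} (hre : z.re < 1 / 2) (hz0 : z ≠ 0) :
    HasDerivAt (fun w => polyLog (s + 1) (w / (w - 1)))
      (polyLog s (z / (z - 1)) / (z * (1 - z))) z := by
  have hz1 : 1 - z ≠ 0 := Complex.slitPlane_ne_zero (one_sub_mem_slitPlane_of_re_le hre.le)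
  have hz1' : z - 1 ≠ 0 := by rwa [← neg_ne_zero, neg_sub]
  refine ((hasDerivAt_polyLog s (norm_div_sub_one_lt_one hre) (div_ne_zero hz0 hz1')).comp z
    ((hasDerivAt_id z).fun_div ((hasDerivAt_id z).sub_const 1) hz1')).congr_deriv ?_
  simp only [id_eq]
  field_simp
  ring

theorem polyLog_one_div_sub_one {z : ℂ} (hre : z.re < 1 / 2) :
    polyLog 1 (z / (z - 1)) = Complex.log (1 - z) := by
  have h_slit := one_sub_mem_slitPlane_of_re_le hre.le
  have hz1 : 1 - z ≠ 0 := Complex.slitPlane_ne_zero h_slit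
  have hz1' : z - 1 ≠ 0 := by rwa [← neg_ne_zero, neg_sub]
  have h_inv : 1 - z / (z - 1) = (1 - z)⁻¹ := by
    field_simp
    ring
  rw [polyLog_one_eq (norm_div_sub_one_lt_one hre), h_inv,
    Complex.log_inv _ (Complex.slitPlane_arg_ne_pi h_slit), neg_neg]

/-- The part `‖z‖ ≤ 1`, `Re z ≤ 1 / 2` of the closed unit disc, which is the part that the
involution `z ↦ z / (z - 1)` maps into the closed unit disc. It is the domain of Landen's
identities. -/
def landenDomain : Set ℂ := {z | ‖z‖ ≤ 1 ∧ z.re ≤ 1 / 2}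

theorem ofReal_mul_mem_landenDomain {z : ℂ} (hz : z ∈ landenDomain) {s : ℝ}
    (hs : s ∈ Icc (0 : ℝ) 1) : (s : ℂ) * z ∈ landenDomain := by
  constructor
  · rw [norm_mul, Complex.norm_real, Real.norm_of_nonneg hs.1]
    exact mul_le_one₀ hs.2 (norm_nonneg z) hz.1
  · rw [Complex.re_ofReal_mul]
    nlinarith [hz.2, hs.1, hs.2]

theorem norm_ofReal_mul_lt_one {z : ℂ} (hz : ‖z‖ ≤ 1) {s : ℝ} (hs : s ∈ Ico (0 : ℝ) 1) :
    ‖(s : ℂ) * z‖ < 1 := by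
  rw [norm_mul, Complex.norm_real, Real.norm_of_nonneg hs.1]
  exact (mul_le_of_le_one_right hs.1 hz).trans_lt hs.2

theorem re_ofReal_mul_lt_half {z : ℂ} (hre : z.re ≤ 1 / 2) {s : ℝ} (hs : s ∈ Ico (0 : ℝ) 1) :
    ((s : ℂ) * z).re < 1 / 2 := by
  rw [Complex.re_ofReal_mul]
  nlinarith [hs.1, hs.2]

theorem continuousOn_log_one_sub :
    ContinuousOn (fun z : ℂ => Complex.log (1 - z)) landenDomain :=
  fun _ hz => (hasDerivAt_log_one_sub (one_sub_mem_slitPlane_of_re_le hz.2)).continuousAt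
    |>.continuousWithinAt

theorem continuousOn_polyLog_landenDomain {s : ℕ} (hs : 2 ≤ s) :
    ContinuousOn (polyLog s) landenDomain :=
  (continuousOn_polyLog hs).mono fun _ hz => mem_closedBall_zero_iff.mpr hz.1

theorem continuousOn_polyLog_div_sub_one {s : ℕ} (hs : 2 ≤ s) :
    ContinuousOn (fun z : ℂ => polyLog s (z / (z - 1))) landenDomain := by
  refine (continuousOn_polyLog hs).comp (continuousOn_id.div (by fun_prop) fun z hz => ?_)
    fun z hz => mem_closedBall_zero_iff.mpr (norm_div_sub_one_le_one hz.2)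
  rw [← neg_ne_zero, neg_sub]
  exact Complex.slitPlane_ne_zero (one_sub_mem_slitPlane_of_re_le hz.2)

theorem hasDerivAt_polyLog_two_landen {z : ℂ} (hz : ‖z‖ < 1) (hre : z.re < 1 / 2) (hz0 : z ≠ 0) :
    HasDerivAt (fun w => polyLog 2 (w / (w - 1)) + polyLog 2 w + Complex.log (1 - w) ^ 2 / 2)
      0 z := by
  have h_slit := one_sub_mem_slitPlane_of_re_le hre.le
  have hz1 := Complex.slitPlane_ne_zero h_slit
  refine (((hasDerivAt_polyLog_div_sub_one 1 hre hz0).add (hasDerivAt_polyLog 1 hz hz0)).add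
    (((hasDerivAt_log_one_sub h_slit).fun_pow 2).div_const 2)).congr_deriv ?_
  rw [polyLog_one_div_sub_one hre, polyLog_one_eq hz]
  field_simp
  ring

theorem polyLog_two_div_sub_one {z : ℂ} (hz : z ∈ landenDomain) :
    polyLog 2 (z / (z - 1)) = -polyLog 2 z - Complex.log (1 - z) ^ 2 / 2 := by
  rcases eq_or_ne z 0 with rfl | hz0
  · simp [polyLog_zero_right]
  have h_cont : ContinuousOn (fun w => polyLog 2 (w / (w - 1)) + polyLog 2 w +
      Complex.log (1 - w) ^ 2 / 2) landenDomain :=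
    ((continuousOn_polyLog_div_sub_one le_rfl).add (continuousOn_polyLog_landenDomain le_rfl)).add
      ((continuousOn_log_one_sub.pow 2).div_const 2)
  have h_const := integral_mul_eq_sub_of_hasDerivAt_segment (F' := 0)
    (h_cont.comp (by fun_prop) fun s hs => ofReal_mul_mem_landenDomain hz hs)
    (fun s hs => hasDerivAt_polyLog_two_landen
      (norm_ofReal_mul_lt_one hz.1 (Ioo_subset_Ico_self hs))
      (re_ofReal_mul_lt_half hz.2 (Ioo_subset_Ico_self hs))
      (mul_ne_zero (by exact_mod_cast hs.1.ne') hz0)) (by simp)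
  simp only [Pi.zero_apply, zero_mul, intervalIntegral.integral_zero, zero_div, sub_zero,
    Complex.log_one, polyLog_zero_right, add_zero, ne_eq, OfNat.ofNat_ne_zero, not_false_eq_true,
    zero_pow] at h_const
  linear_combination -h_const

/-- The closed form of the Nielsen polylogarithm given by Landen's identity for the trilogarithm:
the two functions agree on `landenDomain`. -/
noncomputable def landenTrilog (z : ℂ) : ℂ :=
  polyLog 3 (z / (z - 1)) + polyLog 3 z - Complex.log (1 - z) * polyLog 2 z -
    Complex.log (1 - z) ^ 3 / 6

theorem continuousOn_landenTrilog : ContinuousOn landenTrilog landenDomain :=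
  (((continuousOn_polyLog_div_sub_one (by norm_num)).add
    (continuousOn_polyLog_landenDomain (by norm_num))).sub
    (continuousOn_log_one_sub.mul (continuousOn_polyLog_landenDomain le_rfl))).sub
    ((continuousOn_log_one_sub.pow 3).div_const 6)

theorem hasDerivAt_landenTrilog {z : ℂ} (hz : ‖z‖ < 1) (hre : z.re < 1 / 2) (hz0 : z ≠ 0) :
    HasDerivAt landenTrilog (Complex.log (1 - z) ^ 2 / (2 * z)) z := by
  have h_slit := one_sub_mem_slitPlane_of_re_le hre.le
  have hz1 := Complex.slitPlane_ne_zero h_slit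
  have h_log := hasDerivAt_log_one_sub h_slit
  refine ((((hasDerivAt_polyLog_div_sub_one 2 hre hz0).add (hasDerivAt_polyLog 2 hz hz0)).sub
    (h_log.mul (hasDerivAt_polyLog 1 hz hz0))).sub ((h_log.pow 3).div_const 6)).congr_deriv ?_
  rw [polyLog_two_div_sub_one ⟨hz.le, hre.le⟩, polyLog_one_eq hz]
  field_simp
  ring

theorem nielsenPolyLog_eq_landenTrilog {z : ℂ} (hz : z ∈ landenDomain) :
    nielsenPolyLog z = landenTrilog z := by
  rcases eq_or_ne z 0 with rfl | hz0
  · simp [nielsenPolyLog_zero, landenTrilog, polyLog_zero_right]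
  rw [nielsenPolyLog_eq_sub (F := landenTrilog) (one_sub_mem_slitPlane_of_re_le hz.2)
    (continuousOn_landenTrilog.comp (by fun_prop) fun s hs => ofReal_mul_mem_landenDomain hz hs)
    fun s hs => hasDerivAt_landenTrilog (norm_ofReal_mul_lt_one hz.1 (Ioo_subset_Ico_self hs))
      (re_ofReal_mul_lt_half hz.2 (Ioo_subset_Ico_self hs))
      (mul_ne_zero (by exact_mod_cast hs.1.ne') hz0)]
  simp [landenTrilog, polyLog_zero_right]

theorem continuousOn_nielsenPolyLog : ContinuousOn nielsenPolyLog landenDomain :=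
  continuousOn_landenTrilog.congr fun _ hz => nielsenPolyLog_eq_landenTrilog hz

theorem norm_one_sub_mul_I (x : ℝ) : ‖1 - x * Complex.I‖ = √(1 + x ^ 2) := by
  rw [Complex.norm_def, Complex.normSq_apply]
  congr 1
  simp
  ring

theorem log_one_sub_mul_I_re (x : ℝ) :
    (Complex.log (1 - x * Complex.I)).re = log (1 + x ^ 2) / 2 := by
  rw [Complex.log_re, norm_one_sub_mul_I, Real.log_sqrt (by positivity)]

theorem log_one_sub_mul_I_im (x : ℝ) :
    (Complex.log (1 - x * Complex.I)).im = -arctan x := by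
  have h_re : (1 - x * Complex.I).re = 1 := by simp
  have h_im : (1 - x * Complex.I).im = -x := by simp
  rw [Complex.log_im, Complex.arg_of_re_nonneg (by rw [h_re]; exact zero_le_one),
    norm_one_sub_mul_I, h_im, neg_div, arcsin_neg, ← arctan_eq_arcsin]

theorem nielsenPolyLog_I_im :
    (nielsenPolyLog Complex.I).im = 3 * π ^ 3 / 128 + π * log 2 ^ 2 / 32 -
      log 2 * catalanConstant / 2 - (polyLog 3 ((1 + Complex.I) / 2)).im := by
  have h_div : Complex.I / (Complex.I - 1) = starRingEnd ℂ ((1 + Complex.I) / 2) := by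
    have h_ne : Complex.I - 1 ≠ 0 := sub_ne_zero.mpr fun h => by
      simpa using congrArg Complex.im h
    rw [map_div₀, map_add, map_one, Complex.conj_I, Complex.conj_ofNat]
    field_simp
    linear_combination Complex.I_sq
  have h_re : (Complex.log (1 - Complex.I)).re = log 2 / 2 := by
    simpa [one_add_one_eq_two] using log_one_sub_mul_I_re 1
  have h_im : (Complex.log (1 - Complex.I)).im = -(π / 4) := by
    simpa using log_one_sub_mul_I_im 1
  have h_six : (6 : ℂ) = (6 : ℝ) := by norm_num
  rw [nielsenPolyLog_eq_landenTrilog ⟨by simp, by simp⟩, landenTrilog, h_div, polyLog_conj, h_six,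
    Complex.sub_im, Complex.div_ofReal_im, Complex.sub_im, Complex.add_im, Complex.conj_im,
    Complex.mul_im, pow_succ, sq, Complex.mul_im, Complex.mul_im, Complex.mul_re, h_re, h_im,
    polyLog_three_I_im, polyLog_two_I_im, polyLog_two_I_re]
  ring

theorem integral_re_circleMap_eq_sub {F G : ℂ → ℂ} {r a b : ℝ} (hr : r ≠ 0)
    (hF : ∀ ω, HasDerivAt F (G (circleMap 0 r ω) / circleMap 0 r ω) (circleMap 0 r ω))
    (h_int : IntervalIntegrable (fun ω => (G (circleMap 0 r ω)).re) volume a b) :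
    ∫ ω in a..b, (G (circleMap 0 r ω)).re =
      (F (circleMap 0 r b)).im - (F (circleMap 0 r a)).im := by
  refine intervalIntegral.integral_eq_sub_of_hasDerivAt
    (f := fun ω => (F (circleMap 0 r ω)).im) (fun ω _ => ?_) h_int
  refine (Complex.imCLM.hasFDerivAt.comp_hasDerivAt ω
    ((hF ω).comp ω (hasDerivAt_circleMap 0 r ω))).congr_deriv ?_
  rw [← mul_assoc, div_mul_cancel₀ _ (circleMap_ne_center hr), Complex.imCLM_apply,
    Complex.mul_I_im]

/-- The odd function `log² (1 - z) - log² (1 + z)`, integrated along quarter circles. -/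
noncomputable def logSqDiff (z : ℂ) : ℂ := Complex.log (1 - z) ^ 2 - Complex.log (1 + z) ^ 2

theorem hasDerivAt_two_mul_nielsenPolyLog_sub {z : ℂ} (hz : ‖z‖ < 1) (hz0 : z ≠ 0) :
    HasDerivAt (fun w => 2 * (nielsenPolyLog w - nielsenPolyLog (-w))) (logSqDiff z / z) z := by
  have h_neg : HasDerivAt (fun w => nielsenPolyLog (-w)) (Complex.log (1 + z) ^ 2 / (2 * z)) z := by
    refine ((hasDerivAt_nielsenPolyLog (by rwa [norm_neg]) (neg_ne_zero.mpr hz0)).comp z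
      (hasDerivAt_neg z)).congr_deriv ?_
    rw [sub_neg_eq_add]
    field_simp
  refine (((hasDerivAt_nielsenPolyLog hz hz0).sub h_neg).const_mul 2).congr_deriv ?_
  rw [logSqDiff]
  field_simp

theorem norm_log_sq_le {w : ℂ} {u : ℝ} (hu : 0 < u) (hu1 : u ≤ 1) (hw : u ≤ ‖w‖) (hw2 : ‖w‖ ≤ 2) :
    ‖Complex.log w‖ ^ 2 ≤ 64 * u ^ (-(1 / 2) : ℝ) := by
  have h_one : 1 ≤ u ^ (-(1 / 4) : ℝ) := one_le_rpow_of_pos_of_le_one_of_nonpos hu hu1 (by norm_num)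
  have h_log : -log u ≤ 4 * u ^ (-(1 / 4) : ℝ) := by
    have h := Real.log_le_rpow_div (inv_nonneg.mpr hu.le) (ε := 1 / 4) (by norm_num)
    rw [Real.log_inv, Real.inv_rpow hu.le, ← Real.rpow_neg hu.le] at h
    linarith
  have h_re : |(Complex.log w).re| ≤ 4 * u ^ (-(1 / 4) : ℝ) := by
    rw [Complex.log_re, abs_le]
    have := Real.log_le_log hu hw
    have := Real.log_le_log (hu.trans_le hw) hw2
    constructor <;> linarith [Real.log_two_lt_d9]
  have h_im : |(Complex.log w).im| ≤ 4 * u ^ (-(1 / 4) : ℝ) := by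
    rw [Complex.log_im]
    linarith [Complex.abs_arg_le_pi w, pi_le_four]
  have h_norm : ‖Complex.log w‖ ≤ 8 * u ^ (-(1 / 4) : ℝ) := by
    linarith [Complex.norm_le_abs_re_add_abs_im (Complex.log w)]
  calc ‖Complex.log w‖ ^ 2 ≤ (8 * u ^ (-(1 / 4) : ℝ)) ^ 2 := by gcongr
    _ = 64 * u ^ (-(1 / 2) : ℝ) := by
      rw [mul_pow, ← Real.rpow_mul_natCast hu.le]
      norm_num

theorem norm_one_add_circleMap_le {r : ℝ} (hr : r ∈ Icc (0 : ℝ) 1) (ω : ℝ) :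
    ‖1 + circleMap 0 r ω‖ ≤ 2 := by
  have := norm_add_le 1 (circleMap 0 r ω)
  rw [norm_one, norm_circleMap_zero, abs_of_nonneg hr.1] at this
  linarith [hr.2]

theorem norm_one_sub_circleMap_le {r : ℝ} (hr : r ∈ Icc (0 : ℝ) 1) (ω : ℝ) :
    ‖1 - circleMap 0 r ω‖ ≤ 2 := by
  have := norm_sub_le 1 (circleMap 0 r ω)
  rw [norm_one, norm_circleMap_zero, abs_of_nonneg hr.1] at this
  linarith [hr.2]

theorem one_le_norm_one_add_circleMap {r ω : ℝ} (hr : 0 ≤ r) (hω : 0 ≤ cos ω) :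
    1 ≤ ‖1 + circleMap 0 r ω‖ := by
  refine le_trans ?_ (Complex.re_le_norm _)
  simpa [circleMap_zero, Complex.exp_ofReal_mul_I_re] using mul_nonneg hr hω

theorem sin_le_norm_one_sub_circleMap (r ω : ℝ) : sin ω ≤ ‖1 - circleMap 0 r ω‖ := by
  refine le_of_sq_le_sq ?_ (norm_nonneg _)
  rw [Complex.sq_norm, Complex.normSq_apply, circleMap_zero, Complex.sub_re, Complex.sub_im,
    Complex.re_ofReal_mul, Complex.im_ofReal_mul, Complex.exp_ofReal_mul_I_re,
    Complex.exp_ofReal_mul_I_im, Complex.one_re, Complex.one_im]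
  linarith [sq_nonneg (r - cos ω), sin_sq_add_cos_sq ω,
    show (1 - r * cos ω) * (1 - r * cos ω) + (0 - r * sin ω) * (0 - r * sin ω) =
      1 - 2 * r * cos ω + r ^ 2 * (sin ω ^ 2 + cos ω ^ 2) by ring,
    congrArg (r ^ 2 * ·) (sin_sq_add_cos_sq ω)]

theorem norm_logSqDiff_circleMap_le {r ω : ℝ} (hr : r ∈ Icc (0 : ℝ) 1)
    (hω : ω ∈ Ioc 0 (π / 2)) :
    ‖logSqDiff (circleMap 0 r ω)‖ ≤ 128 * (2 / π * ω) ^ (-(1 / 2) : ℝ) := by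
  have h_pos : 0 < 2 / π * ω := mul_pos (by positivity) hω.1
  have h_sin : 2 / π * ω ≤ sin ω := mul_le_sin hω.1.le hω.2
  have h_one := h_sin.trans (sin_le_one ω)
  have h_cos : 0 ≤ cos ω := cos_nonneg_of_mem_Icc ⟨by linarith [hω.1, pi_pos], hω.2⟩
  have h_sub := norm_log_sq_le h_pos h_one (h_sin.trans (sin_le_norm_one_sub_circleMap r ω))
    (norm_one_sub_circleMap_le hr ω)
  have h_add := norm_log_sq_le h_pos h_one
    (h_one.trans (one_le_norm_one_add_circleMap hr.1 h_cos)) (norm_one_add_circleMap_le hr ω)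
  calc ‖logSqDiff (circleMap 0 r ω)‖
      ≤ ‖Complex.log (1 - circleMap 0 r ω)‖ ^ 2 + ‖Complex.log (1 + circleMap 0 r ω)‖ ^ 2 := by
        rw [← norm_pow, ← norm_pow]
        exact norm_sub_le _ _
    _ ≤ _ := by linarith

theorem intervalIntegrable_const_mul_rpow {c s : ℝ} (hc : c ≠ 0) (hs : -1 < s) (a b C : ℝ) :
    IntervalIntegrable (fun x => C * (c * x) ^ s) volume a b := by
  have h := intervalIntegral.intervalIntegrable_rpow' hs (a := c * a) (b := c * b)
  simpa [mul_div_cancel_left₀ _ hc] using (h.comp_mul_left (c := c)).const_mul C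

theorem aestronglyMeasurable_logSqDiff_circleMap_re (r : ℝ) (μ : Measure ℝ) :
    AEStronglyMeasurable (fun ω => (logSqDiff (circleMap 0 r ω)).re) μ := by
  have : Measurable (circleMap 0 r) := (continuous_circleMap 0 r).measurable
  unfold logSqDiff
  fun_prop

theorem intervalIntegrable_logSqDiff_circleMap_re {r : ℝ} (hr : r ∈ Icc (0 : ℝ) 1) :
    IntervalIntegrable (fun ω => (logSqDiff (circleMap 0 r ω)).re) volume 0 (π / 2) := by
  refine (intervalIntegrable_const_mul_rpow (c := 2 / π) (s := -(1 / 2)) (by positivity)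
    (by norm_num) 0 (π / 2) 128).mono_fun'
    (aestronglyMeasurable_logSqDiff_circleMap_re r _) ?_
  rw [uIoc_of_le (by positivity)]
  filter_upwards [ae_restrict_mem measurableSet_Ioc] with ω hω
  exact (Complex.abs_re_le_norm _).trans (norm_logSqDiff_circleMap_le hr hω)

theorem circleMap_zero_pi_div_two (r : ℝ) : circleMap 0 r (π / 2) = r * Complex.I := by
  rw [circleMap_zero, Complex.ofReal_div, Complex.ofReal_ofNat, Complex.exp_pi_div_two_mul_I]

theorem nielsenPolyLog_ofReal_im {x : ℝ} (hx : x < 1) : (nielsenPolyLog x).im = 0 := by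
  have h := nielsenPolyLog_conj (z := x) (Or.inl (by simpa using hx))
  rw [Complex.conj_ofReal] at h
  exact Complex.conj_eq_iff_im.mp h.symm

theorem nielsenPolyLog_neg_mul_I_im (x : ℝ) :
    (nielsenPolyLog (-(x * Complex.I))).im = -(nielsenPolyLog (x * Complex.I)).im := by
  have h := nielsenPolyLog_conj (z := x * Complex.I) (Or.inl (by simp))
  rw [map_mul, Complex.conj_ofReal, Complex.conj_I, mul_neg] at h
  rw [h, Complex.conj_im]

theorem integral_logSqDiff_circleMap_re {r : ℝ} (hr : r ∈ Ioo (0 : ℝ) 1) :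
    ∫ ω in 0..(π / 2), (logSqDiff (circleMap 0 r ω)).re =
      4 * (nielsenPolyLog (r * Complex.I)).im := by
  have h_norm (ω : ℝ) : ‖circleMap 0 r ω‖ < 1 := by
    rw [norm_circleMap_zero, abs_of_pos hr.1]
    exact hr.2
  rw [integral_re_circleMap_eq_sub hr.1.ne' (fun ω => hasDerivAt_two_mul_nielsenPolyLog_sub
    (h_norm ω) (circleMap_ne_center hr.1.ne'))
    (intervalIntegrable_logSqDiff_circleMap_re (Ioo_subset_Icc_self hr))]
  have h_zero : circleMap 0 r 0 = r := by simp [circleMap_zero]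
  have h_neg := nielsenPolyLog_ofReal_im (x := -r) (by linarith [hr.1])
  rw [Complex.ofReal_neg] at h_neg
  have h_two : (2 : ℂ) = (2 : ℝ) := by norm_num
  rw [circleMap_zero_pi_div_two, h_zero, h_two, Complex.im_ofReal_mul, Complex.im_ofReal_mul,
    Complex.sub_im, Complex.sub_im, nielsenPolyLog_neg_mul_I_im, nielsenPolyLog_ofReal_im hr.2,
    h_neg]
  ring

theorem continuousAt_logSqDiff {z : ℂ} (h_sub : 1 - z ∈ Complex.slitPlane)
    (h_add : 1 + z ∈ Complex.slitPlane) : ContinuousAt logSqDiff z := by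
  unfold logSqDiff
  fun_prop (disch := assumption)

theorem ofReal_mul_I_mem_landenDomain {x : ℝ} (hx : x ∈ Icc (0 : ℝ) 1) :
    (x * Complex.I : ℂ) ∈ landenDomain :=
  ofReal_mul_mem_landenDomain ⟨by simp, by simp⟩ hx

theorem continuousOn_nielsenPolyLog_mul_I_im :
    ContinuousOn (fun x : ℝ => (nielsenPolyLog (x * Complex.I)).im) (Icc 0 1) :=
  Complex.continuous_im.comp_continuousOn
    (continuousOn_nielsenPolyLog.comp (by fun_prop) fun _ => ofReal_mul_I_mem_landenDomain)

theorem tendsto_logSqDiff_circleMap_re {ω : ℝ} (hω : ω ∈ Ioc 0 (π / 2)) :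
    Tendsto (fun r => (logSqDiff (circleMap 0 r ω)).re) (𝓝[<] 1)
      (𝓝 (logSqDiff (circleMap 0 1 ω)).re) := by
  have h_sin : 0 < sin ω := sin_pos_of_pos_of_lt_pi hω.1 (by linarith [hω.2, pi_pos])
  have h_cos : 0 ≤ cos ω := cos_nonneg_of_mem_Icc ⟨by linarith [hω.1, pi_pos], hω.2⟩
  have h_sub : 1 - circleMap 0 1 ω ∈ Complex.slitPlane := Or.inr (by
    simpa [circleMap_zero, Complex.exp_ofReal_mul_I_im] using h_sin.ne')
  have h_add : 1 + circleMap 0 1 ω ∈ Complex.slitPlane := Or.inl (by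
    simpa [circleMap_zero, Complex.exp_ofReal_mul_I_re] using by linarith)
  have h_circle : ContinuousAt (fun r : ℝ => circleMap 0 r ω) 1 := by
    simp only [circleMap_zero]
    fun_prop
  exact ((Complex.continuous_re.continuousAt.comp
    ((continuousAt_logSqDiff h_sub h_add).comp_of_eq h_circle rfl)).tendsto).mono_left
    nhdsWithin_le_nhds

theorem integral_logSqDiff_circleMap_one_re :
    ∫ ω in 0..(π / 2), (logSqDiff (circleMap 0 1 ω)).re = 4 * (nielsenPolyLog Complex.I).im := by
  have h_mem : Ioo (0 : ℝ) 1 ∈ 𝓝[<] (1 : ℝ) := Ioo_mem_nhdsLT one_pos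
  have h_int : Tendsto (fun r => ∫ ω in 0..(π / 2), (logSqDiff (circleMap 0 r ω)).re) (𝓝[<] 1)
      (𝓝 (∫ ω in 0..(π / 2), (logSqDiff (circleMap 0 1 ω)).re)) := by
    refine intervalIntegral.tendsto_integral_filter_of_dominated_convergence
      (fun ω => 128 * (2 / π * ω) ^ (-(1 / 2) : ℝ))
      (.of_forall fun r => aestronglyMeasurable_logSqDiff_circleMap_re r _)
      (eventually_of_mem h_mem fun r hr => .of_forall fun ω hω => ?_)
      (intervalIntegrable_const_mul_rpow (by positivity) (by norm_num) _ _ _)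
      (.of_forall fun ω hω => ?_)
    all_goals rw [uIoc_of_le (by positivity)] at hω
    · exact (Complex.abs_re_le_norm _).trans
        (norm_logSqDiff_circleMap_le (Ioo_subset_Icc_self hr) hω)
    · exact tendsto_logSqDiff_circleMap_re hω
  have h_nielsen : Tendsto (fun r : ℝ => 4 * (nielsenPolyLog (r * Complex.I)).im) (𝓝[<] 1)
      (𝓝 (4 * (nielsenPolyLog Complex.I).im)) := by
    have h := (continuousOn_nielsenPolyLog_mul_I_im 1 (by simp)).mono_of_mem_nhdsWithin
      (Icc_mem_nhdsLT one_pos)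
    simpa using h.tendsto.const_mul 4
  exact tendsto_nhds_unique h_int (h_nielsen.congr' (eventually_of_mem h_mem fun r hr =>
    (integral_logSqDiff_circleMap_re hr).symm))

theorem one_sub_exp_mul_I (ω : ℝ) :
    1 - Complex.exp (ω * Complex.I) =
      (2 * sin (ω / 2) : ℝ) * Complex.exp ((ω / 2 - π / 2 : ℝ) * Complex.I) := by
  have h_exp : Complex.exp (ω * Complex.I) = Complex.exp (ω / 2 * Complex.I) ^ 2 := by
    rw [← Complex.exp_nat_mul]
    push_cast
    ring_nf
  have := Complex.exp_ne_zero (ω / 2 * Complex.I)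
  push_cast
  rw [h_exp, sub_mul, Complex.exp_sub, Complex.exp_pi_div_two_mul_I, Complex.sin, neg_mul,
    Complex.exp_neg]
  field_simp

theorem one_add_exp_mul_I (ω : ℝ) :
    1 + Complex.exp (ω * Complex.I) =
      (2 * cos (ω / 2) : ℝ) * Complex.exp ((ω / 2 : ℝ) * Complex.I) := by
  have h_exp : Complex.exp (ω * Complex.I) = Complex.exp (ω / 2 * Complex.I) ^ 2 := by
    rw [← Complex.exp_nat_mul]
    push_cast
    ring_nf
  have := Complex.exp_ne_zero (ω / 2 * Complex.I)
  push_cast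
  rw [h_exp, Complex.cos, neg_mul, Complex.exp_neg]
  field_simp
  ring

theorem log_ofReal_mul_exp {r θ : ℝ} (hr : 0 < r) (hθ : θ ∈ Ioc (-π) π) :
    Complex.log (r * Complex.exp (θ * Complex.I)) = log r + θ * Complex.I := by
  rw [Complex.log_ofReal_mul hr (Complex.exp_ne_zero _),
    Complex.log_exp (by simpa using hθ.1) (by simpa using hθ.2)]

theorem logSqDiff_circleMap_one_re {ω : ℝ} (hω : ω ∈ Ioo 0 π) :
    (logSqDiff (circleMap 0 1 ω)).re =
      log (tan (ω / 2)) * log (2 * sin ω) + π * (ω / 2 - π / 4) := by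
  have h_sin : 0 < sin (ω / 2) := sin_pos_of_pos_of_lt_pi (by linarith [hω.1])
    (by linarith [hω.2, pi_pos])
  have h_cos : 0 < cos (ω / 2) := cos_pos_of_mem_Ioo ⟨by linarith [hω.1, pi_pos],
    by linarith [hω.2, pi_pos]⟩
  have h_tan : log (tan (ω / 2)) = log (2 * sin (ω / 2)) - log (2 * cos (ω / 2)) := by
    rw [← Real.log_div (by positivity) (by positivity), mul_div_mul_left _ _ two_ne_zero,
      ← tan_eq_sin_div_cos]
  have h_two_sin : log (2 * sin ω) = log (2 * sin (ω / 2)) + log (2 * cos (ω / 2)) := by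
    rw [← Real.log_mul (by positivity) (by positivity)]
    congr 1
    rw [show sin ω = sin (2 * (ω / 2)) by ring_nf, sin_two_mul]
    ring
  have h_arg_sub : ω / 2 - π / 2 ∈ Ioc (-π) π :=
    ⟨by linarith [hω.1, pi_pos], by linarith [hω.2, pi_pos]⟩
  have h_arg_add : ω / 2 ∈ Ioc (-π) π := ⟨by linarith [hω.1, pi_pos], by linarith [hω.2, pi_pos]⟩
  rw [logSqDiff, circleMap_zero, Complex.ofReal_one, one_mul, one_sub_exp_mul_I,
    one_add_exp_mul_I, log_ofReal_mul_exp (by positivity) h_arg_sub,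
    log_ofReal_mul_exp (by positivity) h_arg_add, h_tan, h_two_sin, sq, sq]
  simp only [Complex.sub_re, Complex.mul_re, Complex.add_re, Complex.add_im, Complex.ofReal_re,
    Complex.ofReal_im, Complex.I_re, Complex.I_im, Complex.im_ofReal_mul]
  ring

theorem intervalIntegrable_log_tan_half_mul_log_two_mul_sin :
    IntervalIntegrable (fun θ => log (tan (θ / 2)) * log (2 * sin θ)) volume 0 (π / 2) := by
  have h := (intervalIntegrable_logSqDiff_circleMap_re (r := 1) (by simp)).sub
    (Continuous.intervalIntegrable (u := fun θ => π * (θ / 2 - π / 4)) (by fun_prop) _ _)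
  refine h.congr fun θ hθ => ?_
  rw [uIoc_of_le (by positivity)] at hθ
  simp only [logSqDiff_circleMap_one_re ⟨hθ.1, by linarith [hθ.2, pi_pos]⟩]
  ring

theorem integral_log_tan_half_mul_log_two_mul_sin :
    ∫ θ in 0..(π / 2), log (tan (θ / 2)) * log (2 * sin θ) =
      4 * (nielsenPolyLog Complex.I).im + π ^ 3 / 16 := by
  have h_linear : ∫ θ in 0..(π / 2), π * (θ / 2 - π / 4) = -(π ^ 3 / 16) := by
    rw [intervalIntegral.integral_const_mul, intervalIntegral.integral_sub (by simp) (by simp),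
      intervalIntegral.integral_div, integral_id, intervalIntegral.integral_const]
    simp
    ring
  have h_sum : ∫ θ in 0..(π / 2), (log (tan (θ / 2)) * log (2 * sin θ) + π * (θ / 2 - π / 4)) =
      4 * (nielsenPolyLog Complex.I).im := by
    rw [← integral_logSqDiff_circleMap_one_re]
    refine intervalIntegral.integral_congr_uIoo fun θ hθ => ?_
    rw [uIoo_of_le (by positivity)] at hθ
    exact (logSqDiff_circleMap_one_re ⟨hθ.1, by linarith [hθ.2, pi_pos]⟩).symm
  rw [intervalIntegral.integral_add intervalIntegrable_log_tan_half_mul_log_two_mul_sin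
    (Continuous.intervalIntegrable (by fun_prop) _ _), h_linear] at h_sum
  linarith

theorem hasDerivAt_im_comp_ofReal_mul_I {F : ℂ → ℂ} {F' : ℂ} {x : ℝ}
    (hF : HasDerivAt F F' (x * Complex.I)) :
    HasDerivAt (fun t : ℝ => (F (t * Complex.I)).im) (F' * Complex.I).im x :=
  Complex.imCLM.hasFDerivAt.comp_hasDerivAt x
    (hF.comp x (by simpa using (hasDerivAt_id x).ofReal_comp.mul_const Complex.I))

/-- The inverse tangent integral `Ti_s x = ∑ (-1)ⁿ x^(2n+1) / (2n+1)^s`, encoded as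
`Im Li_s (i x)`. -/
noncomputable def inverseTangentIntegral (s : ℕ) (x : ℝ) : ℝ := (polyLog s (x * Complex.I)).im

theorem inverseTangentIntegral_one {x : ℝ} (hx : |x| < 1) :
    inverseTangentIntegral 1 x = arctan x := by
  rw [inverseTangentIntegral, polyLog_one_eq (by simpa using hx), Complex.neg_im,
    log_one_sub_mul_I_im, neg_neg]

theorem inverseTangentIntegral_two_one : inverseTangentIntegral 2 1 = catalanConstant := by
  rw [inverseTangentIntegral, Complex.ofReal_one, one_mul, polyLog_two_I_im]

theorem inverseTangentIntegral_three_one : inverseTangentIntegral 3 1 = π ^ 3 / 32 := by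
  rw [inverseTangentIntegral, Complex.ofReal_one, one_mul, polyLog_three_I_im]

theorem hasDerivAt_inverseTangentIntegral (s : ℕ) {x : ℝ} (hx : x ∈ Ioo (0 : ℝ) 1) :
    HasDerivAt (inverseTangentIntegral (s + 1)) (inverseTangentIntegral s x / x) x := by
  have h_norm : ‖(x * Complex.I : ℂ)‖ < 1 := by simpa [abs_of_pos hx.1] using hx.2
  refine (hasDerivAt_im_comp_ofReal_mul_I (hasDerivAt_polyLog s h_norm
    (by simpa using hx.1.ne'))).congr_deriv ?_
  rw [← div_div, div_mul_cancel₀ _ Complex.I_ne_zero, Complex.div_ofReal_im, inverseTangentIntegral]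

theorem abs_inverseTangentIntegral_le {s : ℕ} (hs : 2 ≤ s) {x : ℝ} (hx : x ∈ Icc (0 : ℝ) 1) :
    |inverseTangentIntegral s x| ≤ (∑' k : ℕ, 1 / ((k : ℝ) + 1) ^ s) * x := by
  have h_norm : ‖(x * Complex.I : ℂ)‖ = x := by simp [abs_of_nonneg hx.1]
  have h := norm_polyLog_le hs (z := x * Complex.I) (by rw [h_norm]; exact hx.2)
  rw [h_norm] at h
  exact (Complex.abs_im_le_norm _).trans h

theorem continuousOn_inverseTangentIntegral {s : ℕ} (hs : 2 ≤ s) :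
    ContinuousOn (inverseTangentIntegral s) (Icc 0 1) :=
  Complex.continuous_im.comp_continuousOn ((continuousOn_polyLog hs).comp (by fun_prop)
    fun x hx => by simpa [abs_of_nonneg hx.1] using hx.2)

theorem hasDerivAt_nielsenPolyLog_mul_I_im {x : ℝ} (hx : x ∈ Ioo (0 : ℝ) 1) :
    HasDerivAt (fun t : ℝ => (nielsenPolyLog (t * Complex.I)).im)
      (-(arctan x * log (1 + x ^ 2) / (2 * x))) x := by
  have hx0 : (x : ℂ) ≠ 0 := by exact_mod_cast hx.1.ne'
  have h_div (w : ℂ) : w ^ 2 / (2 * (x * Complex.I)) * Complex.I = w ^ 2 / (2 * x : ℝ) := by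
    push_cast
    field_simp
  refine (hasDerivAt_im_comp_ofReal_mul_I (hasDerivAt_nielsenPolyLog
    (by simpa [abs_of_pos hx.1] using hx.2) (by simpa using hx.1.ne'))).congr_deriv ?_
  rw [h_div, Complex.div_ofReal_im, sq, Complex.mul_im, log_one_sub_mul_I_re,
    log_one_sub_mul_I_im]
  ring

theorem tendsto_mul_log_pow_nhdsGT_zero (k : ℕ) :
    Tendsto (fun x : ℝ => x * log x ^ k) (𝓝[>] 0) (𝓝 0) := by
  have h := ((isLittleO_pow_log_id_atTop (n := k)).tendsto_div_nhds_zero.comp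
    tendsto_inv_nhdsGT_zero).const_mul ((-1) ^ k)
  rw [mul_zero] at h
  refine h.congr fun x => ?_
  simp only [Function.comp_apply, id_eq, Real.log_inv, div_inv_eq_mul]
  rw [← mul_assoc, ← mul_pow, neg_one_mul, neg_neg, mul_comm]

theorem tendsto_mul_log_pow_nhdsGT_zero_of_abs_le {f : ℝ → ℝ} {C : ℝ}
    (hf : ∀ x ∈ Ioo (0 : ℝ) 1, |f x| ≤ C * x) (k : ℕ) :
    Tendsto (fun x => f x * log x ^ k) (𝓝[>] 0) (𝓝 0) := by
  have h := (tendsto_mul_log_pow_nhdsGT_zero k).abs.const_mul C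
  rw [abs_zero, mul_zero] at h
  refine squeeze_zero_norm' ?_ h
  filter_upwards [Ioo_mem_nhdsGT one_pos] with x hx
  rw [Real.norm_eq_abs, abs_mul, abs_mul, abs_of_pos hx.1, ← mul_assoc]
  exact mul_le_mul_of_nonneg_right (hf x hx) (abs_nonneg _)

theorem abs_arctan_le {x : ℝ} (hx : 0 ≤ x) : |arctan x| ≤ x := by
  rw [abs_of_nonneg (arctan_nonneg.mpr hx)]
  simpa using le_tan (arctan_nonneg.mpr hx) (arctan_lt_pi_div_two x)

/-- The primitive of `2 arctan x · log (4x / (1 + x²)) / x` that vanishes at `0⁺`. -/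
noncomputable def arctanLogPrimitive (x : ℝ) : ℝ :=
  2 * (log (4 * x) * inverseTangentIntegral 2 x) - 2 * inverseTangentIntegral 3 x +
    4 * (nielsenPolyLog (x * Complex.I)).im

theorem arctanLogPrimitive_one :
    arctanLogPrimitive 1 =
      4 * log 2 * catalanConstant - π ^ 3 / 16 + 4 * (nielsenPolyLog Complex.I).im := by
  have h_log : log 4 = 2 * log 2 := by
    rw [show (4 : ℝ) = 2 ^ 2 by norm_num, Real.log_pow, Nat.cast_ofNat]
  rw [arctanLogPrimitive, inverseTangentIntegral_two_one, inverseTangentIntegral_three_one,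
    mul_one, h_log, Complex.ofReal_one, one_mul]
  ring

theorem hasDerivAt_arctanLogPrimitive {x : ℝ} (hx : x ∈ Ioo (0 : ℝ) 1) :
    HasDerivAt arctanLogPrimitive (2 * arctan x * log (4 * x / (1 + x ^ 2)) / x) x := by
  have hx0 := hx.1.ne'
  have h_log : HasDerivAt (fun t => log (4 * t)) x⁻¹ x := by
    refine (((hasDerivAt_id x).const_mul 4).log (by simpa using hx0)).congr_deriv ?_
    simp only [id]
    field_simp
  refine ((((h_log.mul (hasDerivAt_inverseTangentIntegral 1 hx)).const_mul 2).sub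
    ((hasDerivAt_inverseTangentIntegral 2 hx).const_mul 2)).add
    ((hasDerivAt_nielsenPolyLog_mul_I_im hx).const_mul 4)).congr_deriv ?_
  rw [inverseTangentIntegral_one (by simpa [abs_of_pos hx.1] using hx.2),
    Real.log_div (by simpa using hx0) (by positivity)]
  field_simp
  ring

theorem continuousOn_arctanLogPrimitive : ContinuousOn arctanLogPrimitive (Ioc 0 1) := by
  have h_two := (continuousOn_inverseTangentIntegral le_rfl).mono Ioc_subset_Icc_self
  have h_three := (continuousOn_inverseTangentIntegral (s := 3) (by norm_num)).mono
    Ioc_subset_Icc_self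
  have h_nielsen := continuousOn_nielsenPolyLog_mul_I_im.mono Ioc_subset_Icc_self
  have h_log : ContinuousOn (fun x : ℝ => log (4 * x)) (Ioc 0 1) :=
    (by fun_prop : ContinuousOn (fun x : ℝ => 4 * x) (Ioc 0 1)).log fun x hx => by
      simpa using hx.1.ne'
  unfold arctanLogPrimitive
  fun_prop

theorem tendsto_arctanLogPrimitive_nhdsGT_zero :
    Tendsto arctanLogPrimitive (𝓝[>] 0) (𝓝 0) := by
  have h_bound {s : ℕ} (hs : 2 ≤ s) (k : ℕ) :
      Tendsto (fun x => inverseTangentIntegral s x * log x ^ k) (𝓝[>] 0) (𝓝 0) :=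
    tendsto_mul_log_pow_nhdsGT_zero_of_abs_le
      (fun x hx => abs_inverseTangentIntegral_le hs (Ioo_subset_Icc_self hx)) k
  have h_nielsen : Tendsto (fun x : ℝ => (nielsenPolyLog (x * Complex.I)).im) (𝓝[>] 0) (𝓝 0) := by
    have h := (continuousOn_nielsenPolyLog_mul_I_im 0 (by simp)).mono_of_mem_nhdsWithin
      (Icc_mem_nhdsGT one_pos)
    simpa [nielsenPolyLog_zero] using h.tendsto
  have h := ((((h_bound le_rfl 0).const_mul (log 4)).add (h_bound le_rfl 1)).const_mul 2 |>.sub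
    ((h_bound (s := 3) (by norm_num) 0).const_mul 2)).add (h_nielsen.const_mul 4)
  simp only [mul_zero, add_zero, sub_zero] at h
  refine h.congr' ?_
  filter_upwards [self_mem_nhdsWithin] with x (hx : 0 < x)
  rw [arctanLogPrimitive, Real.log_mul four_ne_zero hx.ne']
  ring

theorem sin_pos_of_mem_Ioo_zero_pi_div_two {θ : ℝ} (hθ : θ ∈ Ioo 0 (π / 2)) : 0 < sin θ :=
  sin_pos_of_pos_of_lt_pi hθ.1 (by linarith [hθ.2, pi_pos])

theorem cos_pos_of_mem_Ioo_zero_pi_div_two {θ : ℝ} (hθ : θ ∈ Ioo 0 (π / 2)) : 0 < cos θ :=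
  cos_pos_of_mem_Ioo ⟨by linarith [hθ.1, pi_pos], hθ.2⟩

theorem cos_half_pos {θ : ℝ} (hθ : θ ∈ Icc 0 (π / 2)) : 0 < cos (θ / 2) :=
  cos_pos_of_mem_Ioo ⟨by linarith [hθ.1, pi_pos], by linarith [hθ.2, pi_pos]⟩

theorem tan_half_mem_Ioo {θ : ℝ} (hθ : θ ∈ Ioo 0 (π / 2)) : tan (θ / 2) ∈ Ioo (0 : ℝ) 1 := by
  refine ⟨tan_pos_of_pos_of_lt_pi_div_two (by linarith [hθ.1]) (by linarith [hθ.1, hθ.2]), ?_⟩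
  rw [← tan_pi_div_four]
  exact tan_lt_tan_of_nonneg_of_lt_pi_div_two (by linarith [hθ.1]) (by linarith [pi_pos])
    (by linarith [hθ.2])

theorem arctan_tan_half {θ : ℝ} (hθ : θ ∈ Ioo 0 (π / 2)) : arctan (tan (θ / 2)) = θ / 2 :=
  arctan_tan (by linarith [hθ.1, pi_pos]) (by linarith [hθ.1, hθ.2])

theorem log_tan_half_nonpos {θ : ℝ} (hθ : θ ∈ Ioo 0 (π / 2)) : log (tan (θ / 2)) ≤ 0 :=
  Real.log_nonpos (tan_half_mem_Ioo hθ).1.le (tan_half_mem_Ioo hθ).2.le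

theorem hasDerivAt_tan_half {θ : ℝ} (hθ : θ ∈ Ioo 0 (π / 2)) :
    HasDerivAt (fun θ : ℝ => tan (θ / 2)) (tan (θ / 2) / sin θ) θ := by
  have h_cos := (cos_half_pos (Ioo_subset_Icc_self hθ)).ne'
  refine (HasDerivAt.comp θ (Real.hasDerivAt_tan h_cos)
    ((hasDerivAt_id θ).div_const 2)).congr_deriv ?_
  have h_tan := (tan_half_mem_Ioo hθ).1.ne'
  rw [sin_eq_two_mul_tan_half_div_one_add_tan_half_sq, id, ← inv_one_add_tan_sq h_cos]
  field_simp

theorem hasDerivAt_comp_tan_half {f : ℝ → ℝ} {f' θ : ℝ} (hθ : θ ∈ Ioo 0 (π / 2))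
    (hf : HasDerivAt f (f' / tan (θ / 2)) (tan (θ / 2))) :
    HasDerivAt (fun θ => f (tan (θ / 2))) (f' / sin θ) θ := by
  have h_tan := (tan_half_mem_Ioo hθ).1.ne'
  refine (hf.comp θ (hasDerivAt_tan_half hθ)).congr_deriv ?_
  field_simp

theorem hasDerivAt_log_tan_half {θ : ℝ} (hθ : θ ∈ Ioo 0 (π / 2)) :
    HasDerivAt (fun θ => log (tan (θ / 2))) (1 / sin θ) θ :=
  hasDerivAt_comp_tan_half hθ
    ((Real.hasDerivAt_log (tan_half_mem_Ioo hθ).1.ne').congr_deriv (one_div _).symm)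

theorem continuousOn_tan_half : ContinuousOn (fun θ : ℝ => tan (θ / 2)) (Icc 0 (π / 2)) :=
  fun _ hθ => (ContinuousAt.comp' (g := tan) (f := fun θ : ℝ => θ / 2)
    (continuousAt_tan.mpr (cos_half_pos hθ).ne') (by fun_prop)).continuousWithinAt

theorem tan_pi_div_two_div_two : tan (π / 2 / 2) = 1 := by
  rw [show π / 2 / 2 = π / 4 by ring, tan_pi_div_four]

theorem tendsto_tan_half_nhdsGT_zero :
    Tendsto (fun θ : ℝ => tan (θ / 2)) (𝓝[>] 0) (𝓝[>] 0) := by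
  refine tendsto_nhdsWithin_iff.mpr ⟨?_, ?_⟩
  · simpa using ((continuousOn_tan_half 0 ⟨le_rfl, by positivity⟩).mono_of_mem_nhdsWithin
      (Icc_mem_nhdsGT (by positivity))).tendsto
  · filter_upwards [Ioo_mem_nhdsGT pi_div_two_pos] with θ hθ
    exact (tan_half_mem_Ioo hθ).1

theorem tendsto_tan_half_nhdsLT_pi_div_two :
    Tendsto (fun θ : ℝ => tan (θ / 2)) (𝓝[<] (π / 2)) (𝓝[<] 1) := by
  refine tendsto_nhdsWithin_iff.mpr ⟨?_, ?_⟩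
  · simpa [tan_pi_div_two_div_two] using ((continuousOn_tan_half (π / 2)
      ⟨by positivity, le_rfl⟩).mono_of_mem_nhdsWithin (Icc_mem_nhdsLT (by positivity))).tendsto
  · filter_upwards [Ioo_mem_nhdsLT pi_div_two_pos] with θ hθ
    exact (tan_half_mem_Ioo hθ).2

theorem tendsto_log_tan_half_nhdsLT_pi_div_two :
    Tendsto (fun θ : ℝ => log (tan (θ / 2))) (𝓝[<] (π / 2)) (𝓝 0) := by
  have h := (Real.continuousAt_log one_ne_zero).tendsto.comp
    (tendsto_tan_half_nhdsLT_pi_div_two.mono_right nhdsWithin_le_nhds)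
  rwa [Real.log_one] at h

theorem intervalIntegrable_log_tan_half :
    IntervalIntegrable (fun θ => log (tan (θ / 2))) volume 0 (π / 2) := by
  have h_sin := (intervalIntegrable_log_sin (a := 0) (b := 2⁻¹ * (π / 2))).comp_mul_left (c := 2⁻¹)
  have h_cos := (intervalIntegrable_log_cos (a := 0) (b := 2⁻¹ * (π / 2))).comp_mul_left (c := 2⁻¹)
  rw [zero_div, mul_div_cancel_left₀ _ (by norm_num)] at h_sin h_cos
  refine (h_sin.sub h_cos).congr_uIoo fun θ hθ => ?_
  rw [uIoo_of_le (by positivity)] at hθ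
  have h_sin_pos : 0 < sin (θ / 2) :=
    sin_pos_of_pos_of_lt_pi (by linarith [hθ.1]) (by linarith [hθ.2, pi_pos])
  simp only [Function.comp_apply, inv_mul_eq_div]
  rw [tan_eq_sin_div_cos,
    Real.log_div h_sin_pos.ne' (cos_half_pos (Ioo_subset_Icc_self hθ)).ne']

theorem intervalIntegrable_mul_of_abs_le {f g : ℝ → ℝ} {a b C : ℝ} (hab : a ≤ b)
    (hf : Measurable f) (hfC : ∀ x ∈ Ioo a b, |f x| ≤ C) (hg : IntervalIntegrable g volume a b) :
    IntervalIntegrable (fun x => f x * g x) volume a b := by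
  rw [intervalIntegrable_iff_integrableOn_Ioo_of_le hab] at hg ⊢
  exact hg.bdd_mul hf.aestronglyMeasurable
    ((ae_restrict_mem measurableSet_Ioo).mono hfC)

theorem intervalIntegrable_sin_pow_mul_cos_mul_log_tan_half (n : ℕ) :
    IntervalIntegrable (fun θ => sin θ ^ n * cos θ * log (tan (θ / 2))) volume 0 (π / 2) := by
  refine intervalIntegrable_mul_of_abs_le (C := 1) (by positivity) (by fun_prop) (fun θ _ => ?_)
    intervalIntegrable_log_tan_half
  rw [abs_mul, abs_pow]
  exact mul_le_one₀ (pow_le_one₀ (abs_nonneg _) (abs_sin_le_one θ)) (abs_nonneg _)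
    (abs_cos_le_one θ)

theorem intervalIntegrable_div_sin_mul_cos_mul_log_tan_half :
    IntervalIntegrable (fun θ => θ / sin θ * cos θ * log (tan (θ / 2))) volume 0 (π / 2) := by
  refine intervalIntegrable_mul_of_abs_le (C := 1) (by positivity) (by fun_prop) (fun θ hθ => ?_)
    intervalIntegrable_log_tan_half
  have h_sin := sin_pos_of_mem_Ioo_zero_pi_div_two hθ
  have h_cos := cos_pos_of_mem_Ioo_zero_pi_div_two hθ
  have h_tan := lt_tan hθ.1 hθ.2
  rw [tan_eq_sin_div_cos, lt_div_iff₀ h_cos] at h_tan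
  rw [abs_of_nonneg (by have := hθ.1; positivity), div_mul_eq_mul_div, div_le_one h_sin]
  exact h_tan.le

theorem log_two_mul_sin_eq (θ : ℝ) :
    log (2 * sin θ) = log (4 * tan (θ / 2) / (1 + tan (θ / 2) ^ 2)) := by
  rw [sin_eq_two_mul_tan_half_div_one_add_tan_half_sq]
  ring_nf

theorem tendsto_sin_mul_log_tan_half_nhdsGT_zero :
    Tendsto (fun θ => sin θ * log (tan (θ / 2))) (𝓝[>] 0) (𝓝 0) := by
  have h_inv : Tendsto (fun x : ℝ => 2 / (1 + x ^ 2)) (𝓝[>] 0) (𝓝 (2 / (1 + 0 ^ 2))) :=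
    (ContinuousAt.tendsto (by fun_prop (disch := norm_num))).mono_left nhdsWithin_le_nhds
  have h := (h_inv.mul (tendsto_mul_log_pow_nhdsGT_zero 1)).comp tendsto_tan_half_nhdsGT_zero
  rw [mul_zero] at h
  refine h.congr fun θ => ?_
  rw [sin_eq_two_mul_tan_half_div_one_add_tan_half_sq, Function.comp_apply]
  ring

theorem hasDerivAt_sin_pow_mul_log_tan_half (n : ℕ) {θ : ℝ} (hθ : θ ∈ Ioo 0 (π / 2)) :
    HasDerivAt (fun θ => sin θ ^ (n + 1) / (n + 1) * log (tan (θ / 2)))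
      (sin θ ^ n * cos θ * log (tan (θ / 2)) + sin θ ^ n / (n + 1)) θ := by
  have h_sin := (sin_pos_of_mem_Ioo_zero_pi_div_two hθ).ne'
  refine ((((hasDerivAt_sin θ).fun_pow (n + 1)).div_const ((n : ℝ) + 1)).mul
    (hasDerivAt_log_tan_half hθ)).congr_deriv ?_
  push_cast
  rw [pow_succ]
  field_simp

theorem tendsto_sin_pow_mul_log_tan_half_nhdsGT_zero (n : ℕ) :
    Tendsto (fun θ => sin θ ^ (n + 1) / (n + 1) * log (tan (θ / 2))) (𝓝[>] 0) (𝓝 0) := by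
  have h_pow : Tendsto (fun θ => sin θ ^ n / (n + 1)) (𝓝[>] 0) (𝓝 (sin 0 ^ n / (n + 1))) :=
    (ContinuousAt.tendsto (by fun_prop)).mono_left nhdsWithin_le_nhds
  have h := h_pow.mul tendsto_sin_mul_log_tan_half_nhdsGT_zero
  rw [mul_zero] at h
  exact h.congr fun θ => by ring

theorem tendsto_sin_pow_mul_log_tan_half_nhdsLT_pi_div_two (n : ℕ) :
    Tendsto (fun θ => sin θ ^ (n + 1) / (n + 1) * log (tan (θ / 2))) (𝓝[<] (π / 2)) (𝓝 0) := by
  have h_pow : Tendsto (fun θ => sin θ ^ (n + 1) / (n + 1)) (𝓝[<] (π / 2))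
      (𝓝 (sin (π / 2) ^ (n + 1) / (n + 1))) :=
    (ContinuousAt.tendsto (by fun_prop)).mono_left nhdsWithin_le_nhds
  simpa using h_pow.mul tendsto_log_tan_half_nhdsLT_pi_div_two

theorem integral_sin_pow_mul_cos_mul_log_tan_half (n : ℕ) :
    ∫ θ in 0..(π / 2), sin θ ^ n * cos θ * log (tan (θ / 2)) =
      -((∫ θ in 0..(π / 2), sin θ ^ n) / (n + 1)) := by
  have h_int := intervalIntegrable_sin_pow_mul_cos_mul_log_tan_half n
  have h_int_pow : IntervalIntegrable (fun θ => sin θ ^ n / (n + 1)) volume 0 (π / 2) :=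
    Continuous.intervalIntegrable (by fun_prop) _ _
  have h := intervalIntegral.integral_eq_sub_of_hasDerivAt_of_tendsto pi_div_two_pos
    (fun θ hθ => hasDerivAt_sin_pow_mul_log_tan_half n hθ) (h_int.add h_int_pow)
    (tendsto_sin_pow_mul_log_tan_half_nhdsGT_zero n)
    (tendsto_sin_pow_mul_log_tan_half_nhdsLT_pi_div_two n)
  rw [intervalIntegral.integral_add h_int h_int_pow, intervalIntegral.integral_div] at h
  linarith

theorem hasDerivAt_mul_log_mul_log_sub_arctanLogPrimitive {θ : ℝ} (hθ : θ ∈ Ioo 0 (π / 2)) :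
    HasDerivAt
      (fun θ => θ * log (2 * sin θ) * log (tan (θ / 2)) - arctanLogPrimitive (tan (θ / 2)))
      (log (tan (θ / 2)) * log (2 * sin θ) + θ / sin θ * cos θ * log (tan (θ / 2))) θ := by
  have h_sin := (sin_pos_of_mem_Ioo_zero_pi_div_two hθ).ne'
  have h_log : HasDerivAt (fun θ => log (2 * sin θ)) (cos θ / sin θ) θ := by
    refine (((hasDerivAt_sin θ).const_mul 2).log (by simpa using h_sin)).congr_deriv ?_
    field_simp
  refine ((((hasDerivAt_id θ).fun_mul h_log).fun_mul (hasDerivAt_log_tan_half hθ)).sub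
    (hasDerivAt_comp_tan_half hθ
      (hasDerivAt_arctanLogPrimitive (tan_half_mem_Ioo hθ)))).congr_deriv ?_
  rw [arctan_tan_half hθ, ← log_two_mul_sin_eq]
  simp only [id]
  field_simp
  ring

theorem tendsto_mul_log_two_mul_sin_mul_log_tan_half_nhdsGT_zero :
    Tendsto (fun θ => θ * log (2 * sin θ) * log (tan (θ / 2))) (𝓝[>] 0) (𝓝 0) := by
  have h_arctan (k : ℕ) : Tendsto (fun x => arctan x * log x ^ k) (𝓝[>] 0) (𝓝 0) :=
    tendsto_mul_log_pow_nhdsGT_zero_of_abs_le (C := 1)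
      (fun x hx => by simpa using abs_arctan_le hx.1.le) k
  have h_log : Tendsto (fun x : ℝ => log 4 - log (1 + x ^ 2)) (𝓝[>] 0)
      (𝓝 (log 4 - log (1 + 0 ^ 2))) :=
    (ContinuousAt.tendsto (by fun_prop (disch := norm_num))).mono_left nhdsWithin_le_nhds
  have h := (((h_log.mul (h_arctan 1)).add (h_arctan 2)).const_mul 2).comp
    tendsto_tan_half_nhdsGT_zero
  rw [mul_zero, add_zero, mul_zero] at h
  refine h.congr' ?_
  filter_upwards [Ioo_mem_nhdsGT pi_div_two_pos] with θ hθ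
  have h_tan := (tan_half_mem_Ioo hθ).1.ne'
  rw [Function.comp_apply, log_two_mul_sin_eq, Real.log_div (by simpa using h_tan) (by positivity),
    Real.log_mul four_ne_zero h_tan, arctan_tan_half hθ]
  ring

theorem tendsto_mul_log_two_mul_sin_mul_log_tan_half_nhdsLT_pi_div_two :
    Tendsto (fun θ => θ * log (2 * sin θ) * log (tan (θ / 2))) (𝓝[<] (π / 2)) (𝓝 0) := by
  have h_sin : Tendsto (fun θ => θ * log (2 * sin θ)) (𝓝[<] (π / 2))
      (𝓝 (π / 2 * log (2 * sin (π / 2)))) :=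
    (ContinuousAt.tendsto (by fun_prop (disch := simp))).mono_left nhdsWithin_le_nhds
  simpa using h_sin.mul tendsto_log_tan_half_nhdsLT_pi_div_two

theorem integral_div_sin_mul_cos_mul_log_tan_half :
    ∫ θ in 0..(π / 2), θ / sin θ * cos θ * log (tan (θ / 2)) =
      -(8 * (nielsenPolyLog Complex.I).im + 4 * log 2 * catalanConstant) := by
  have h_zero := tendsto_mul_log_two_mul_sin_mul_log_tan_half_nhdsGT_zero.sub
    (tendsto_arctanLogPrimitive_nhdsGT_zero.comp tendsto_tan_half_nhdsGT_zero)
  have h_one : Tendsto arctanLogPrimitive (𝓝[<] 1) (𝓝 (arctanLogPrimitive 1)) :=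
    ((continuousOn_arctanLogPrimitive 1 (by simp)).mono_of_mem_nhdsWithin
      (Ioc_mem_nhdsLT one_pos)).tendsto
  have h_pi := tendsto_mul_log_two_mul_sin_mul_log_tan_half_nhdsLT_pi_div_two.sub
    (h_one.comp tendsto_tan_half_nhdsLT_pi_div_two)
  have h := intervalIntegral.integral_eq_sub_of_hasDerivAt_of_tendsto pi_div_two_pos
    (fun θ hθ => hasDerivAt_mul_log_mul_log_sub_arctanLogPrimitive hθ)
    (intervalIntegrable_log_tan_half_mul_log_two_mul_sin.add
      intervalIntegrable_div_sin_mul_cos_mul_log_tan_half) h_zero h_pi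
  rw [intervalIntegral.integral_add intervalIntegrable_log_tan_half_mul_log_two_mul_sin
    intervalIntegrable_div_sin_mul_cos_mul_log_tan_half,
    integral_log_tan_half_mul_log_two_mul_sin, arctanLogPrimitive_one] at h
  linarith

theorem intervalIntegrable_div_sin :
    IntervalIntegrable (fun θ => θ / sin θ) volume 0 (π / 2) := by
  have h := intervalIntegrable_mul_of_abs_le (f := fun θ => θ / sin θ) (C := π / 2) (a := 0)
    (b := π / 2) pi_div_two_pos.le (by fun_prop) (fun θ hθ => ?_)
    (intervalIntegrable_const (c := 1))
  · simpa using h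
  · have h_sin := sin_pos_of_mem_Ioo_zero_pi_div_two hθ
    have h_le := mul_le_sin hθ.1.le hθ.2.le
    rw [abs_of_pos (div_pos hθ.1 h_sin), div_le_iff₀ h_sin]
    calc θ = π / 2 * (2 / π * θ) := by field_simp
      _ ≤ π / 2 * sin θ := by gcongr

theorem integral_div_sin : ∫ θ in 0..(π / 2), θ / sin θ = 2 * catalanConstant := by
  have h_deriv (θ : ℝ) (hθ : θ ∈ Ioo 0 (π / 2)) :
      HasDerivAt (fun θ => 2 * inverseTangentIntegral 2 (tan (θ / 2))) (θ / sin θ) θ := by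
    have h_tan := tan_half_mem_Ioo hθ
    refine ((hasDerivAt_comp_tan_half hθ
      (hasDerivAt_inverseTangentIntegral 1 h_tan)).const_mul 2).congr_deriv ?_
    rw [inverseTangentIntegral_one (by simpa [abs_of_pos h_tan.1] using h_tan.2),
      arctan_tan_half hθ]
    ring
  have h_cont := continuousOn_inverseTangentIntegral le_rfl
  have h_zero : Tendsto (inverseTangentIntegral 2) (𝓝[>] 0) (𝓝 0) := by
    simpa using tendsto_mul_log_pow_nhdsGT_zero_of_abs_le
      (fun x hx => abs_inverseTangentIntegral_le le_rfl (Ioo_subset_Icc_self hx)) 0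
  have h_one : Tendsto (inverseTangentIntegral 2) (𝓝[<] 1) (𝓝 catalanConstant) := by
    rw [← inverseTangentIntegral_two_one]
    exact ((h_cont 1 (by simp)).mono_of_mem_nhdsWithin (Icc_mem_nhdsLT one_pos)).tendsto
  rw [intervalIntegral.integral_eq_sub_of_hasDerivAt_of_tendsto pi_div_two_pos h_deriv
    intervalIntegrable_div_sin ((h_zero.comp tendsto_tan_half_nhdsGT_zero).const_mul 2)
    ((h_one.comp tendsto_tan_half_nhdsLT_pi_div_two).const_mul 2)]
  ring

theorem hasSum_intervalIntegral_of_nonneg {f : ℕ → ℝ → ℝ} {g : ℝ → ℝ} {a b : ℝ} (hab : a ≤ b)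
    (hf : ∀ n, IntervalIntegrable (f n) volume a b)
    (hf_nonneg : ∀ n, ∀ x ∈ Ioo a b, 0 ≤ f n x)
    (hg : IntervalIntegrable g volume a b)
    (hfg : ∀ x ∈ Ioo a b, HasSum (fun n => f n x) (g x)) :
    HasSum (fun n => ∫ x in a..b, f n x) (∫ x in a..b, g x) := by
  have h_mem : ∀ᵐ x, x ∈ uIoc a b → x ∈ Ioo a b := by
    rw [uIoc_of_le hab]
    exact Ioo_ae_eq_Ioc.mem_iff.mono fun x hx => hx.mpr
  refine intervalIntegral.hasSum_integral_of_dominated_convergence f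
    (fun n => (hf n).def'.aestronglyMeasurable) (fun n => ?_) ?_ ?_ ?_
  · filter_upwards [h_mem] with x hx h
    exact (Real.norm_of_nonneg (hf_nonneg n x (hx h))).le
  · filter_upwards [h_mem] with x hx h
    exact (hfg x (hx h)).summable
  · refine hg.congr_uIoo fun x hx => ?_
    rw [uIoo_of_le hab] at hx
    exact (hfg x hx).tsum_eq.symm
  · filter_upwards [h_mem] with x hx h
    exact hfg x (hx h)

theorem hasSum_centralRatio_sq_div :
    HasSum (fun n : ℕ => centralRatio n ^ 2 / (2 * n + 1)) (4 / π * catalanConstant) := by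
  have h := hasSum_intervalIntegral_of_nonneg pi_div_two_pos.le
    (f := fun n θ => centralRatio n / (2 * n + 1) * sin θ ^ (2 * n))
    (fun n => Continuous.intervalIntegrable (by fun_prop) _ _)
    (fun n θ _ => mul_nonneg (div_nonneg (centralRatio_pos n).le (by positivity))
      ((even_two_mul n).pow_nonneg _))
    intervalIntegrable_div_sin fun θ hθ => hasSum_centralRatio_div_mul_sin_pow hθ
  simp only [intervalIntegral.integral_const_mul, integral_sin_pow_even_zero_pi_div_two,
    integral_div_sin] at h
  have h_eq : 2 / π * (2 * catalanConstant) = 4 / π * catalanConstant := by ring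
  refine (h_eq ▸ h.mul_left (2 / π)).congr_fun fun n => ?_
  field_simp

theorem hasSum_centralRatio_sq_div_sq_nielsenPolyLog :
    HasSum (fun n : ℕ => 1 / (2 * (n : ℝ) + 1) ^ 2 * centralRatio n ^ 2)
      (2 / π * (8 * (nielsenPolyLog Complex.I).im + 4 * log 2 * catalanConstant)) := by
  have h := hasSum_intervalIntegral_of_nonneg pi_div_two_pos.le
    (f := fun n θ => -(centralRatio n / (2 * n + 1) *
      (sin θ ^ (2 * n) * cos θ * log (tan (θ / 2)))))
    (fun n => ((intervalIntegrable_sin_pow_mul_cos_mul_log_tan_half _).const_mul _).neg)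
    (fun n θ hθ => ?_)
    intervalIntegrable_div_sin_mul_cos_mul_log_tan_half.neg fun θ hθ =>
      ((((hasSum_centralRatio_div_mul_sin_pow hθ).mul_right (cos θ)).mul_right
        (log (tan (θ / 2)))).neg).congr_fun fun n => by ring
  · simp only [intervalIntegral.integral_neg, intervalIntegral.integral_const_mul,
      integral_sin_pow_mul_cos_mul_log_tan_half, integral_sin_pow_even_zero_pi_div_two,
      Pi.neg_apply, integral_div_sin_mul_cos_mul_log_tan_half, neg_neg] at h
    refine (h.mul_left (2 / π)).congr_fun fun n => ?_
    push_cast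
    field_simp
  · exact neg_nonneg.mpr (mul_nonpos_of_nonneg_of_nonpos
      (div_nonneg (centralRatio_pos n).le (by positivity))
      (mul_nonpos_of_nonneg_of_nonpos (mul_nonneg ((even_two_mul n).pow_nonneg _)
        (cos_pos_of_mem_Ioo_zero_pi_div_two hθ).le) (log_tan_half_nonpos hθ)))

theorem hasSum_centralRatio_sq_div_sq :
    HasSum (fun n : ℕ => 1 / (2 * (n : ℝ) + 1) ^ 2 * centralRatio n ^ 2)
      (3 * π ^ 2 / 8 + log 2 ^ 2 / 2 - 16 / π * (polyLog 3 ((1 + Complex.I) / 2)).im) := by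
  have h := hasSum_centralRatio_sq_div_sq_nielsenPolyLog
  rw [nielsenPolyLog_I_im] at h
  convert h using 1
  field_simp
  ring

theorem hasSum_centralRatio_sq_div_pow_four :
    HasSum (fun n : ℕ => 1 / (2 * (n : ℝ) - 1) ^ 4 * centralRatio n ^ 2)
      (3 * π ^ 2 / 8 + log 2 ^ 2 / 2 - 16 / π * (polyLog 3 ((1 + Complex.I) / 2)).im
        - 8 / π * (catalanConstant - 1)) := by
  rw [← hasSum_nat_add_iff' 1]
  have h := (hasSum_centralRatio_sq_div_sq.add hasSum_centralRatio_sq_mul).sub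
    (hasSum_centralRatio_sq_div.mul_left 2)
  convert h using 1
  · funext n
    have h_cast : 2 * ((n + 1 : ℕ) : ℝ) - 1 = 2 * n + 1 := by push_cast; ring
    rw [centralRatio_succ, h_cast]
    field_simp
    ring
  · rw [Finset.range_one, Finset.sum_singleton, centralRatio_zero]
    norm_num
    ring

theorem mainTheorem5 :
    (Summable (hypergeometricTerm ![1/2, 1/2, 1/2, 1/2] ![1, 3/2, 3/2] 1) ∧
      HasSum (fun n : ℕ => 1 / (2 * (n : ℝ) + 1) ^ 2 * (1 / 4 ^ n * ((2 * n).choose n : ℝ)) ^ 2)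
        (hypergeometricPFQ ![1/2, 1/2, 1/2, 1/2] ![1, 3/2, 3/2] 1) ∧
      hypergeometricPFQ ![1/2, 1/2, 1/2, 1/2] ![1, 3/2, 3/2] 1 =
        3 * Real.pi ^ 2 / 8 + Real.log 2 ^ 2 / 2
          - 16 / Real.pi * (polyLog 3 ((1 + Complex.I) / 2)).im) ∧
    (Summable (hypergeometricTerm ![-1/2, -1/2, -1/2, -1/2] ![1, 1/2, 1/2] 1) ∧
      HasSum (fun n : ℕ => 1 / (2 * (n : ℝ) - 1) ^ 4 * (1 / 4 ^ n * ((2 * n).choose n : ℝ)) ^ 2)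
        (hypergeometricPFQ ![-1/2, -1/2, -1/2, -1/2] ![1, 1/2, 1/2] 1) ∧
      hypergeometricPFQ ![-1/2, -1/2, -1/2, -1/2] ![1, 1/2, 1/2] 1 =
        3 * Real.pi ^ 2 / 8 + Real.log 2 ^ 2 / 2
          - 16 / Real.pi * (polyLog 3 ((1 + Complex.I) / 2)).im
          - 8 / Real.pi * (catalanConstant - 1)) := by
  have h_half := hasSum_centralRatio_sq_div_sq.congr_fun hypergeometricTerm_one_half
  have h_neg_half := hasSum_centralRatio_sq_div_pow_four.congr_fun hypergeometricTerm_neg_one_half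
  have h_half_value := h_half.tsum_eq
  have h_neg_half_value := h_neg_half.tsum_eq
  refine ⟨⟨h_half.summable, ?_, h_half_value⟩, h_neg_half.summable, ?_, h_neg_half_value⟩
  · rw [hypergeometricPFQ, h_half_value]
    exact hasSum_centralRatio_sq_div_sq
  · rw [hypergeometricPFQ, h_neg_half_value]
    exact hasSum_centralRatio_sq_div_pow_four
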